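/- Let $b,c>0$ and let $V\in L^1(\mathbb R)$ be real valued, with negative part $V_-:=(V-|V|)/2$. Let $\hat u(\lambda)=\frac1{\sqrt{2\pi}}\int_{\mathbb R}e^{-i\lambda x}u(x)\,dx$ denote the unitary Fourier transform, and let $\dot H^{1/2}(\mathbb R)$ be the completion of $H^{1/2}(\mathbb R)=\{u\in L^2(\mathbb R): |\lambda|^{1/2}\hat u\in L^2(\mathbb R)\}$ with respect to the norm $\|u\|_{\dot H^{1/2}}=\||\lambda|^{1/2}\hat u\|_{L^2}$. Let $\mathcal L$ (formally $c^2|D|+b^2|D|^{-1}+|D|^{-1}V$ with $D=-i\,d/dx$) be the operator in $\dot H^{1/2}(\mathbb R)$ associated with the quadratic form $$\mathfrak t_V[u]=c^2\int_{\mathbb R}|u'|^2\,dx+b^2\int_{\mathbb R}|u|^2\,dx+\int_{\mathbb R}V|u|^2\,dx,\qquad \mathrm{dom}(\mathfrak t_V)=H^1(\mathbb R),$$ that is, $u\in\mathrm{dom}(\mathcal L)$ and $\mathcal L u=w$ if and only if $u\in H^1(\mathbb R)$, $w\in\dot H^{1/2}(\mathbb R)$ and $\mathfrak t_V[v,u]=\langle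 v,w\rangle_{\dot H^{1/2}}$ for all $v\in H^1(\mathbb R)$, where $\mathfrak t_V[\cdot,\cdot]$ is the corresponding sesquilinear form, and both it and the inner product are conjugate linear in the first argument. Then $\mathcal L$ is self-adjoint, and its spectral projection $P_{(-\infty,0]}(\mathcal L)$ (the value on $(-\infty,0]$ of the projection-valued spectral measure of $\mathcal L$) has finite rank with $$\dim P_{(-\infty,0]}(\mathcal L)\;\le\;\frac1{2bc}\int_{\mathbb R}|V_-(y)|\,dy .$$ -/

import Mathlib

open MeasureTheory FourierTransform TemperedDistribution
open scoped SchwartzMap LineDeriv ENNReal ComplexConjugate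

noncomputable section

namespace HamiltonianKrein

/-- The complex Hilbert space `L²(ℝ)`. -/
abbrev L2 : Type := Lp ℂ 2 (volume : Measure ℝ)

/-! ### Sobolev spaces -/

/-- With Mathlib's normalization of the Fourier transform `𝓕`, the variable `ξ` corresponds to
`λ = 2πξ`, and `|λ| dλ`-weighted integrals of the unitary Fourier transform become
`2π|ξ| dξ`-weighted integrals of `𝓕 u`. This is the weight `|λ|^{1/2}`. -/
def halfWeight (ξ : ℝ) : ℝ := Real.sqrt (2 * Real.pi * |ξ|)

/-- `H^{1/2}(ℝ) = {u ∈ L² : |λ|^{1/2} û ∈ L²}`, as a subspace of `L²(ℝ)`. -/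
def hHalf : Submodule ℂ L2 where
  carrier := {u | MemLp (fun ξ ↦ (halfWeight ξ : ℂ) * (𝓕 u : L2) ξ) 2 volume}
  zero_mem' := by
    have : (𝓕 (0 : L2) : L2) = 0 := map_zero (Lp.fourierTransformₗᵢ ℝ ℂ)
    refine (MemLp.zero (ε := ℂ) (p := 2) (μ := (volume : Measure ℝ))).ae_eq ?_
    rw [this]
    filter_upwards [Lp.coeFn_zero ℂ 2 (volume : Measure ℝ)] with ξ h
    simp
  add_mem' := by
    intro u v hu hv
    refine (MemLp.add hu hv).ae_eq ?_
    rw [FourierTransform.fourier_add]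
    filter_upwards [Lp.coeFn_add (𝓕 u : L2) (𝓕 v : L2)] with ξ h
    simp only [Pi.add_apply, h, mul_add]
  smul_mem' := by
    intro a u hu
    refine (MemLp.const_smul hu a).ae_eq ?_
    rw [FourierTransform.fourier_smul]
    filter_upwards [Lp.coeFn_smul a (𝓕 u : L2)] with ξ h
    simp [h]
    ring

/-- The space `H^{1/2}(ℝ)` as a vector space, which will carry the homogeneous norm
`‖ |D|^{1/2} u ‖_{L²}` instead of the norm of `L²(ℝ)`. -/
def HHalf : Type := hHalf

instance : AddCommGroup HHalf := inferInstanceAs (AddCommGroup hHalf)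
instance : Module ℂ HHalf := inferInstanceAs (Module ℂ hHalf)

/-- The element of `H^{1/2}(ℝ)` given by `u ∈ L²(ℝ)` with `|λ|^{1/2} û ∈ L²`. -/
def toHHalf : hHalf →ₗ[ℂ] HHalf := LinearMap.id

/-- The map `u ↦ |λ|^{1/2} û(λ)` from `H^{1/2}(ℝ)` to `L²(ℝ)`. -/
def j₀ : HHalf →ₗ[ℂ] L2 where
  toFun u := MemLp.toLp _ (Subtype.property (p := (· ∈ hHalf)) u)
  map_add' := by
    intro u v
    obtain ⟨u, hu⟩ := u
    obtain ⟨v, hv⟩ := v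
    refine Eq.trans ?_ (MemLp.toLp_add hu hv)
    refine MemLp.toLp_congr _ _ ?_
    change (fun ξ ↦ (halfWeight ξ : ℂ) * (𝓕 (u + v) : L2) ξ) =ᵐ[volume] _
    rw [FourierTransform.fourier_add]
    filter_upwards [Lp.coeFn_add (𝓕 u : L2) (𝓕 v : L2)] with ξ h
    simp only [Pi.add_apply, h, mul_add]
  map_smul' := by
    intro a u
    obtain ⟨u, hu⟩ := u
    refine Eq.trans ?_ (MemLp.toLp_const_smul a hu)
    refine MemLp.toLp_congr _ _ ?_
    change (fun ξ ↦ (halfWeight ξ : ℂ) * (𝓕 (a • u) : L2) ξ) =ᵐ[volume] _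
    rw [FourierTransform.fourier_smul]
    filter_upwards [Lp.coeFn_smul a (𝓕 u : L2)] with ξ h
    simp [h]
    ring

/-- The norm `‖u‖ = ‖ |λ|^{1/2} û ‖_{L²}` on `H^{1/2}(ℝ)`. -/
instance : SeminormedAddCommGroup HHalf := SeminormedAddCommGroup.induced HHalf L2 j₀

instance : InnerProductSpace ℂ HHalf := InnerProductSpace.induced j₀

/-- The homogeneous Sobolev space `Ḣ^{1/2}(ℝ)`: the completion of `H^{1/2}(ℝ)` with respect to the
norm `‖ |λ|^{1/2} û ‖_{L²}`. -/
abbrev HDot : Type := UniformSpace.Completion HHalf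

/-- The Sobolev space `H¹(ℝ)` as a subspace of `L²(ℝ)`. -/
def H1 : Submodule ℂ L2 where
  carrier := {u | MemSobolev 1 2 (u : 𝓢'(ℝ, ℂ))}
  zero_mem' := by
    have := memSobolev_fun_zero ℝ ℂ 1 2
    rw [← map_zero (Lp.toTemperedDistributionCLM ℂ (volume : Measure ℝ) 2)] at this
    exact this
  add_mem' := by
    intro u v hu hv
    have := MemSobolev.add hu hv
    simp only [← Lp.toTemperedDistributionCLM_apply, ← map_add] at this
    exact this
  smul_mem' := by
    intro a u hu
    have := MemSobolev.smul a hu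
    simp only [← Lp.toTemperedDistributionCLM_apply, ← map_smul] at this
    exact this

theorem toTempered_injective {u v : L2} (h : (u : 𝓢'(ℝ, ℂ)) = (v : 𝓢'(ℝ, ℂ))) : u = v := by
  have := Lp.ker_toTemperedDistributionCLM_eq_bot (F := ℂ) (μ := (volume : Measure ℝ)) (p := 2)
  exact LinearMap.ker_eq_bot.mp this h

theorem exists_weakDeriv (u : H1) :
    ∃ w : L2, ∂_{(1 : ℝ)} ((u : L2) : 𝓢'(ℝ, ℂ)) = (w : 𝓢'(ℝ, ℂ)) := by
  have h := MemSobolev.lineDerivOp (m := (1 : ℝ)) u.2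
  rw [sub_self] at h
  exact memSobolev_zero_iff.mp h

/-- The weak (distributional) derivative `u' ∈ L²(ℝ)` of `u ∈ H¹(ℝ)`. -/
def weakDeriv : H1 →ₗ[ℂ] L2 where
  toFun u := (exists_weakDeriv u).choose
  map_add' u v := by
    apply toTempered_injective
    rw [← (exists_weakDeriv (u + v)).choose_spec]
    simp only [← Lp.toTemperedDistributionCLM_apply, map_add, Submodule.coe_add]
    rw [LineDerivAdd.lineDerivOp_add]
    simp only [Lp.toTemperedDistributionCLM_apply, ← (exists_weakDeriv u).choose_spec,
      ← (exists_weakDeriv v).choose_spec]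
  map_smul' a u := by
    apply toTempered_injective
    rw [← (exists_weakDeriv (a • u)).choose_spec]
    simp only [← Lp.toTemperedDistributionCLM_apply, map_smul, Submodule.coe_smul,
      RingHom.id_apply]
    rw [LineDerivSMul.lineDerivOp_smul]
    simp only [Lp.toTemperedDistributionCLM_apply, ← (exists_weakDeriv u).choose_spec]

theorem weakDeriv_spec (u : H1) :
    ∂_{(1 : ℝ)} ((u : L2) : 𝓢'(ℝ, ℂ)) = (weakDeriv u : 𝓢'(ℝ, ℂ)) :=
  (exists_weakDeriv u).choose_spec

/-! ### The form and the operator -/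

/-- The weight `(1 + ξ²)^{-1/2}`. -/
def besselWeight (ξ : ℝ) : ℝ := (1 + ‖ξ‖ ^ 2) ^ (-1 / 2 : ℝ)

theorem besselWeight_nonneg (ξ : ℝ) : 0 ≤ besselWeight ξ :=
  Real.rpow_nonneg (by have := sq_nonneg ‖ξ‖; linarith) _

theorem besselWeight_le_one (ξ : ℝ) : besselWeight ξ ≤ 1 :=
  Real.rpow_le_one_of_one_le_of_nonpos (by have := sq_nonneg ‖ξ‖; linarith) (by norm_num)

theorem besselWeight_eq (ξ : ℝ) : besselWeight ξ = (Real.sqrt (1 + ‖ξ‖ ^ 2))⁻¹ := by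
  rw [besselWeight, show (-1 / 2 : ℝ) = -(1 / 2) by norm_num,
    Real.rpow_neg (by have := sq_nonneg ‖ξ‖; linarith), ← Real.sqrt_eq_rpow]

theorem besselWeight_sq (ξ : ℝ) : besselWeight ξ ^ 2 = (1 + ξ ^ 2)⁻¹ := by
  rw [besselWeight_eq, inv_pow, Real.sq_sqrt (by have := sq_nonneg ‖ξ‖; linarith),
    Real.norm_eq_abs, sq_abs]

theorem continuous_besselWeight : Continuous (fun ξ ↦ (besselWeight ξ : ℂ)) := by
  refine Complex.continuous_ofReal.comp ?_
  exact Continuous.rpow_const (by fun_prop)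
    (fun x ↦ Or.inl (by have := sq_nonneg ‖x‖; linarith))

/-- On the Fourier side, `û = (1 + ξ²)^{-1/2} g` with `g ∈ L²` for every `u ∈ H¹(ℝ)`. -/
theorem exists_fourier_eq (u : H1) : ∃ g : L2,
    ((𝓕 (u : L2) : L2) : ℝ → ℂ) =ᵐ[volume] fun ξ ↦ (besselWeight ξ : ℂ) * g ξ := by
  obtain ⟨g, hg⟩ := memSobolev_iff_exists_smulLeftCLM_fourier.mp u.2
  have hb : MemLp (fun ξ : ℝ ↦ (besselWeight ξ : ℂ)) ∞ volume := by
    refine memLp_top_of_bound (C := 1) continuous_besselWeight.aestronglyMeasurable ?_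
    filter_upwards with ξ
    rw [Complex.norm_real, Real.norm_eq_abs, abs_of_nonneg (besselWeight_nonneg ξ)]
    exact besselWeight_le_one ξ
  have hg1 : (fun ξ : ℝ ↦ (besselWeight ξ : ℂ)).HasTemperateGrowth := by
    unfold besselWeight
    fun_prop
  refine ⟨g, ?_⟩
  have key : (𝓕 (u : L2) : L2) = (hb.toLp _ • g : L2) := by
    apply toTempered_injective
    rw [Lp.toTemperedDistribution_smul_eq hg1, ← hg,
      smulLeftCLM_smulLeftCLM_apply (by fun_prop) hg1,
      Lp.fourier_toTemperedDistribution_eq]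
    convert! (smulLeftCLM_const 1 ((𝓕 (u : L2) : L2) : 𝓢'(ℝ, ℂ))).symm using 1
    · rw [one_smul]
    · congr
      ext x
      rw [Pi.mul_apply, ← Complex.ofReal_mul, besselWeight,
        ← Real.rpow_add (by have := sq_nonneg ‖x‖; linarith),
        show (1 / 2 + -1 / 2 : ℝ) = 0 by norm_num, Real.rpow_zero, Complex.ofReal_one]
  rw [key]
  filter_upwards [Lp.coeFn_lpSMul (r := 2) (hb.toLp _) g, hb.coeFn_toLp] with x h h'
  rw [h, Pi.smul_apply', h', smul_eq_mul]

theorem H1_le_hHalf : H1 ≤ hHalf := by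
  intro u hu
  obtain ⟨g, hg⟩ := exists_fourier_eq ⟨u, hu⟩
  change MemLp (fun ξ ↦ (halfWeight ξ : ℂ) * (𝓕 u : L2) ξ) 2 volume
  have hm : AEStronglyMeasurable (fun ξ ↦ (halfWeight ξ : ℂ) * (𝓕 u : L2) ξ) volume := by
    refine AEStronglyMeasurable.mul ?_ (Lp.aestronglyMeasurable _)
    refine Continuous.aestronglyMeasurable ?_
    unfold halfWeight
    fun_prop
  refine MemLp.of_le_mul (c := Real.sqrt (2 * Real.pi)) (Lp.memLp g) hm ?_
  filter_upwards [hg] with ξ h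
  rw [h, norm_mul, norm_mul, ← mul_assoc]
  refine mul_le_mul_of_nonneg_right ?_ (norm_nonneg _)
  rw [Complex.norm_real, Complex.norm_real, Real.norm_eq_abs, Real.norm_eq_abs, halfWeight,
    abs_of_nonneg (Real.sqrt_nonneg _), abs_of_nonneg (besselWeight_nonneg ξ),
    Real.sqrt_mul (by positivity) |ξ|, mul_assoc, besselWeight_eq, ← div_eq_mul_inv]
  refine mul_le_of_le_one_right (Real.sqrt_nonneg _) ?_
  refine div_le_one_of_le₀ (Real.sqrt_le_sqrt ?_) (Real.sqrt_nonneg _)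
  rw [Real.norm_eq_abs]
  nlinarith [sq_nonneg (|ξ| - 1), abs_nonneg ξ]

/-- The functions of `H¹(ℝ)` are essentially bounded. -/
theorem exists_ae_bound (u : H1) : ∃ C : ℝ, ∀ᵐ x, ‖(u : L2) x‖ ≤ C := by
  obtain ⟨g, hg⟩ := exists_fourier_eq u
  have hw : MemLp (fun ξ : ℝ ↦ (besselWeight ξ : ℂ)) 2 volume := by
    rw [memLp_two_iff_integrable_sq_norm continuous_besselWeight.aestronglyMeasurable]
    refine (integrable_inv_one_add_sq).congr ?_
    filter_upwards with ξ
    rw [Complex.norm_real, Real.norm_eq_abs, sq_abs, besselWeight_sq]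
  have hL1 : Integrable ((𝓕 (u : L2) : L2) : ℝ → ℂ) volume :=
    (MemLp.integrable_mul hw (Lp.memLp g)).congr hg.symm
  set w : L2 := 𝓕 (u : L2) with hw'
  refine ⟨∫ ξ, ‖w ξ‖, ?_⟩
  have hbound : ∀ x, ‖𝓕⁻ (w : ℝ → ℂ) x‖ ≤ ∫ ξ, ‖w ξ‖ := by
    intro x
    rw [Real.fourierInv_eq]
    refine (norm_integral_le_integral_norm _).trans_eq ?_
    simp
  have hneg : Integrable (fun ξ ↦ w (-ξ)) volume := hL1.comp_neg
  have hflip : 𝓕⁻ (w : ℝ → ℂ) = 𝓕 (fun ξ ↦ w (-ξ)) := Real.fourierInv_eq_fourier_comp_neg _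
  have hcont : Continuous (𝓕⁻ (w : ℝ → ℂ)) := by
    rw [hflip]
    exact VectorFourier.fourierIntegral_continuous Real.continuous_fourierChar
      (L := innerₗ ℝ) continuous_inner hneg
  suffices h : ((u : L2) : ℝ → ℂ) =ᵐ[volume] 𝓕⁻ (w : ℝ → ℂ) by
    filter_upwards [h] with x hx
    rw [hx]
    exact hbound x
  refine ae_eq_of_integral_contDiff_smul_eq
    ((Lp.memLp (u : L2)).locallyIntegrable (by norm_num)) hcont.locallyIntegrable ?_
  intro φ φ_smooth φ_cpt
  have h₁ : HasCompactSupport (Complex.ofRealCLM ∘ φ) := φ_cpt.comp_left rfl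
  have h₂ : ContDiff ℝ (⊤ : ℕ∞) (Complex.ofRealCLM ∘ φ) := by fun_prop
  set ψ : 𝓢(ℝ, ℂ) := h₁.toSchwartzMap h₂ with hψ
  have hψx : ∀ x, ψ x = (φ x : ℂ) := fun x ↦ rfl
  have e1 : ((u : L2) : 𝓢'(ℝ, ℂ)) ψ = ((w : L2) : 𝓢'(ℝ, ℂ)) (𝓕⁻ ψ) := by
    rw [hw', ← Lp.fourier_toTemperedDistribution_eq, TemperedDistribution.fourier_apply,
      FourierTransform.fourier_fourierInv_eq]
  have e2 : ∫ ξ, 𝓕 (ψ : ℝ → ℂ) ξ • w (-ξ) = ∫ x, ψ x • 𝓕 (fun ξ ↦ w (-ξ)) x := by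
    simpa using! VectorFourier.integral_fourierIntegral_smul_eq_flip (L := innerₗ ℝ)
      Real.continuous_fourierChar continuous_inner ψ.integrable hneg
  rw [Lp.toTemperedDistribution_apply, Lp.toTemperedDistribution_apply] at e1
  have e3 : ∫ ξ, (𝓕⁻ ψ) ξ • w ξ = ∫ ξ, 𝓕 (ψ : ℝ → ℂ) ξ • w (-ξ) := by
    rw [← integral_neg_eq_self (fun ξ ↦ 𝓕 (ψ : ℝ → ℂ) ξ • w (-ξ))]
    refine integral_congr_ae (Filter.Eventually.of_forall fun ξ ↦ ?_)
    simp only [neg_neg]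
    rw [SchwartzMap.fourierInv_coe, Real.fourierInv_eq_fourier_neg]
  have e4 := e1.trans (e3.trans e2)
  rw [← hflip] at e4
  simpa [hψx] using e4

theorem integrable_form {V : ℝ → ℝ} (hV : Integrable V) (u v : H1) :
    Integrable (fun x ↦ (V x : ℂ) * (conj ((u : L2) x) * (v : L2) x)) := by
  obtain ⟨C, hC⟩ := exists_ae_bound u
  obtain ⟨C', hC'⟩ := exists_ae_bound v
  refine Integrable.mul_bdd (c := C * C') hV.ofReal ?_ ?_
  · exact ((Lp.aestronglyMeasurable (u : L2)).star).mul (Lp.aestronglyMeasurable (v : L2))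
  · filter_upwards [hC, hC'] with x h h'
    rw [norm_mul, RCLike.norm_conj]
    exact mul_le_mul h h' (norm_nonneg _) ((norm_nonneg _).trans h)

/-- The embedding of `H¹(ℝ)` into `Ḣ^{1/2}(ℝ)`. -/
def toHDot : H1 →ₗ[ℂ] HDot where
  toFun u := (toHHalf (Submodule.inclusion H1_le_hHalf u) : HDot)
  map_add' u v := by
    rw [map_add, map_add, UniformSpace.Completion.coe_add]
  map_smul' a u := by
    rw [map_smul, map_smul, UniformSpace.Completion.coe_smul, RingHom.id_apply]

theorem mem_H1_of_fourier (u g : L2)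
    (h : (g : ℝ → ℂ) =ᵐ[volume] fun ξ ↦ (((1 + ‖ξ‖ ^ 2) ^ ((1 : ℝ) / 2) : ℝ) : ℂ) * (𝓕 u : L2) ξ) :
    u ∈ H1 := by
  refine memSobolev_iff_exists_smulLeftCLM_fourier.mpr ⟨g, ?_⟩
  rw [Lp.fourier_toTemperedDistribution_eq]
  ext φ
  have ht : (fun ξ : ℝ ↦ (((1 + ‖ξ‖ ^ 2) ^ ((1 : ℝ) / 2) : ℝ) : ℂ)).HasTemperateGrowth := by
    fun_prop
  rw [smulLeftCLM_apply_apply, Lp.toTemperedDistribution_apply, Lp.toTemperedDistribution_apply]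
  refine integral_congr_ae ?_
  filter_upwards [h] with ξ hξ
  rw [hξ, SchwartzMap.smulLeftCLM_apply_apply ht]
  simp only [smul_eq_mul]
  ring

/-- `H¹(ℝ)` is dense in `Ḣ^{1/2}(ℝ)`. -/
theorem denseRange_toHDot : DenseRange toHDot := by
  have hsub : Set.range ((↑) : HHalf → HDot) ⊆ closure (Set.range toHDot) := by
    rintro _ ⟨u, rfl⟩
    obtain ⟨u, hu⟩ := u
    set w : L2 := 𝓕 u with hw
    let S : ℕ → Set ℝ := fun n ↦ Set.Icc (-(n : ℝ)) n
    have hS : ∀ n, MeasurableSet (S n) := fun n ↦ measurableSet_Icc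
    have hwn : ∀ n, MemLp ((S n).indicator (w : ℝ → ℂ)) 2 volume :=
      fun n ↦ (Lp.memLp w).indicator (hS n)
    let wn : ℕ → L2 := fun n ↦ (hwn n).toLp _
    let un : ℕ → L2 := fun n ↦ 𝓕⁻ (wn n)
    have hfun : ∀ n, (𝓕 (un n) : L2) = wn n := fun n ↦ FourierTransform.fourier_fourierInv_eq _
    have hmem : ∀ n, un n ∈ H1 := by
      intro n
      have hb : MemLp (fun ξ ↦ (((1 + ‖ξ‖ ^ 2) ^ ((1 : ℝ) / 2) : ℝ) : ℂ)
          * (S n).indicator (w : ℝ → ℂ) ξ) 2 volume := by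
        refine MemLp.of_le_mul (c := (1 + (n : ℝ) ^ 2) ^ ((1 : ℝ) / 2)) (Lp.memLp w) ?_ ?_
        · refine AEStronglyMeasurable.mul ?_ (hwn n).1
          refine Continuous.aestronglyMeasurable (Complex.continuous_ofReal.comp ?_)
          exact Continuous.rpow_const (by fun_prop) (fun x ↦ Or.inr (by norm_num))
        · refine Filter.Eventually.of_forall fun ξ ↦ ?_
          by_cases hξ : ξ ∈ S n
          · rw [Set.indicator_of_mem hξ, norm_mul, Complex.norm_real, Real.norm_eq_abs,
              abs_of_nonneg (by positivity)]
            refine mul_le_mul_of_nonneg_right ?_ (norm_nonneg _)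
            refine Real.rpow_le_rpow (by positivity) ?_ (by norm_num)
            have : ‖ξ‖ ≤ n := abs_le.mpr hξ
            gcongr
          · rw [Set.indicator_of_notMem hξ, mul_zero, norm_zero]
            positivity
      refine mem_H1_of_fourier (un n) (hb.toLp _) ?_
      rw [hfun]
      filter_upwards [hb.coeFn_toLp, (hwn n).coeFn_toLp] with ξ h1 h2
      rw [h1, h2]
    refine mem_closure_of_tendsto (f := fun n ↦ toHDot ⟨un n, hmem n⟩) (b := Filter.atTop) ?_
      (Filter.Eventually.of_forall fun n ↦ ⟨_, rfl⟩)
    change Filter.Tendsto (fun n ↦ ((toHHalf ⟨un n, H1_le_hHalf (hmem n)⟩ : HHalf) : HDot))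
      Filter.atTop (nhds ((toHHalf ⟨u, hu⟩ : HHalf) : HDot))
    refine ((UniformSpace.Completion.continuous_coe HHalf).tendsto _).comp ?_
    rw [tendsto_iff_norm_sub_tendsto_zero]
    have hnorm : ∀ n, ‖toHHalf ⟨un n, H1_le_hHalf (hmem n)⟩ - toHHalf ⟨u, hu⟩‖
        = ‖j₀ (toHHalf ⟨un n, H1_le_hHalf (hmem n)⟩) - j₀ (toHHalf ⟨u, hu⟩)‖ := by
      intro n
      have h := map_sub j₀ (toHHalf ⟨un n, H1_le_hHalf (hmem n)⟩) (toHHalf ⟨u, hu⟩)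
      rw [← h]
      rfl
    simp only [hnorm]
    rw [← tendsto_iff_norm_sub_tendsto_zero]
    have hG : MemLp (fun ξ ↦ (halfWeight ξ : ℂ) * w ξ) 2 volume := hu
    refine Lp.tendsto_Lp_iff_tendsto_eLpNorm' _ _ |>.mpr ?_
    have hae : ∀ n, (j₀ (toHHalf ⟨un n, H1_le_hHalf (hmem n)⟩) - j₀ (toHHalf ⟨u, hu⟩) : ℝ → ℂ)
        =ᵐ[volume] (S n)ᶜ.indicator (fun ξ ↦ -((halfWeight ξ : ℂ) * w ξ)) := by
      intro n
      filter_upwards [MemLp.coeFn_toLp (H1_le_hHalf (hmem n)), MemLp.coeFn_toLp hu,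
        (hwn n).coeFn_toLp] with ξ h1 h2 h3
      change (MemLp.toLp _ (H1_le_hHalf (hmem n)) : L2) ξ - (MemLp.toLp _ hu : L2) ξ = _
      rw [h1, h2, hfun, h3, ← hw]
      by_cases hξ : ξ ∈ S n
      · simp [hξ]
      · simp [hξ]
    simp only [fun n ↦ eLpNorm_congr_ae (p := 2) (hae n)]
    have hind : ∀ n, eLpNorm ((S n)ᶜ.indicator (fun ξ ↦ -((halfWeight ξ : ℂ) * w ξ))) 2 volume
        = (∫⁻ ξ, ‖(S n)ᶜ.indicator (fun ξ ↦ -((halfWeight ξ : ℂ) * w ξ)) ξ‖ₑ ^ (2 : ℝ))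
          ^ (1 / 2 : ℝ) := by
      intro n
      rw [eLpNorm_eq_lintegral_rpow_enorm_toReal (by norm_num) (by norm_num)]
      norm_num
    simp only [hind]
    have hlim : Filter.Tendsto (fun n ↦ ∫⁻ ξ,
        ‖(S n)ᶜ.indicator (fun ξ ↦ -((halfWeight ξ : ℂ) * w ξ)) ξ‖ₑ ^ (2 : ℝ))
        Filter.atTop (nhds (∫⁻ _ : ℝ, 0)) := by
      refine tendsto_lintegral_of_dominated_convergence'
        (fun ξ ↦ ‖(halfWeight ξ : ℂ) * w ξ‖ₑ ^ (2 : ℝ)) ?_ ?_ ?_ ?_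
      · intro n
        exact ((hG.1.neg.indicator (hS n).compl).enorm).pow_const _
      · intro n
        refine Filter.Eventually.of_forall fun ξ ↦ ?_
        by_cases hξ : ξ ∈ S n
        · simp [hξ]
        · simp [hξ]
      · have := hG.2
        rw [eLpNorm_lt_top_iff_lintegral_rpow_enorm_lt_top (by norm_num) (by norm_num)] at this
        exact (by simpa using this : _ < _).ne
      · refine Filter.Eventually.of_forall fun ξ ↦ ?_
        obtain ⟨N, hN⟩ := exists_nat_ge |ξ|
        refine tendsto_const_nhds.congr' ?_
        filter_upwards [Filter.eventually_ge_atTop N] with n hn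
        have hξ : ξ ∈ S n := abs_le.mp (hN.trans (Nat.cast_le.mpr hn))
        simp [hξ]
    have := (ENNReal.continuous_rpow_const (y := (1 / 2 : ℝ))).tendsto _ |>.comp hlim
    simpa [Function.comp_def] using this
  have h := (UniformSpace.Completion.denseRange_coe (α := HHalf)).closure_range
  have h2 := closure_minimal hsub isClosed_closure
  rw [h] at h2
  exact dense_iff_closure_eq.mpr (Set.univ_subset_iff.mp h2)

theorem toHDot_injective : Function.Injective toHDot := by
  refine (injective_iff_map_eq_zero toHDot).mpr ?_
  rintro ⟨u, hu⟩ h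
  have hu' : u ∈ hHalf := H1_le_hHalf hu
  have h1 : ‖((toHHalf ⟨u, hu'⟩ : HHalf) : HDot)‖ = 0 := by
    change ‖toHDot ⟨u, hu⟩‖ = 0
    rw [h, norm_zero]
  rw [UniformSpace.Completion.norm_coe] at h1
  have h2 : (MemLp.toLp _ hu' : L2) = 0 := norm_eq_zero.mp h1
  have h3 : (𝓕 u : L2) = 0 := by
    rw [Lp.eq_zero_iff_ae_eq_zero]
    have h4 : ∀ᵐ ξ : ℝ, ξ ≠ 0 := by
      simp [ae_iff]
    filter_upwards [MemLp.coeFn_toLp hu', (Lp.eq_zero_iff_ae_eq_zero).mp h2, h4] with ξ a1 a2 a3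
    rw [a1] at a2
    have a4 : halfWeight ξ ≠ 0 := by
      have : 0 < |ξ| := abs_pos.mpr a3
      exact (Real.sqrt_pos.mpr (by positivity)).ne'
    simpa [a4] using a2
  have h5 : u = 0 := (Lp.fourierTransformₗᵢ ℝ ℂ).map_eq_zero_iff.mp h3
  exact Subtype.ext h5

/-- The sesquilinear form of `𝔱_V[u] = c² ∫ |u'|² + b² ∫ |u|² + ∫ V |u|²`, `u ∈ H¹(ℝ)`
(conjugate linear in the first variable). -/
def tForm (b c : ℝ) (V : ℝ → ℝ) (u v : H1) : ℂ :=
  (c : ℂ) ^ 2 * inner ℂ (weakDeriv u) (weakDeriv v) + (b : ℂ) ^ 2 * inner ℂ (u : L2) (v : L2)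
    + ∫ x, (V x : ℂ) * (conj ((u : L2) x) * (v : L2) x)

/-- The graph of the operator associated with the form `𝔱_V` in `Ḣ^{1/2}(ℝ)`: the pairs `(u, w)`
with `u ∈ H¹(ℝ)` and `𝔱_V[v, u] = ⟨v, w⟩` for all `v ∈ H¹(ℝ)`. -/
def opGraph (b c : ℝ) (V : ℝ → ℝ) (hV : Integrable V) : Submodule ℂ (HDot × HDot) where
  carrier := {p | ∃ u : H1, toHDot u = p.1 ∧ ∀ v : H1, tForm b c V v u = inner ℂ (toHDot v) p.2}
  zero_mem' := ⟨0, by simp, fun v ↦ by simp [tForm]⟩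
  add_mem' := by
    rintro p q ⟨u, hu, hu'⟩ ⟨w, hw, hw'⟩
    refine ⟨u + w, by simp [hu, hw], fun v ↦ ?_⟩
    have h : (fun x ↦ (V x : ℂ) * (conj ((v : L2) x) * ((u + w : H1) : L2) x)) =ᵐ[volume]
        fun x ↦ (V x : ℂ) * (conj ((v : L2) x) * (u : L2) x)
          + (V x : ℂ) * (conj ((v : L2) x) * (w : L2) x) := by
      filter_upwards [Lp.coeFn_add (u : L2) (w : L2)] with x hx
      rw [Submodule.coe_add, hx, Pi.add_apply]
      ring
    rw [Prod.snd_add, inner_add_right, ← hu', ← hw', tForm, tForm, tForm, integral_congr_ae h,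
      integral_add (integrable_form hV v u) (integrable_form hV v w), map_add, Submodule.coe_add,
      inner_add_right, inner_add_right]
    ring
  smul_mem' := by
    rintro a p ⟨u, hu, hu'⟩
    refine ⟨a • u, by simp [hu], fun v ↦ ?_⟩
    have h : (fun x ↦ (V x : ℂ) * (conj ((v : L2) x) * ((a • u : H1) : L2) x)) =ᵐ[volume]
        fun x ↦ a * ((V x : ℂ) * (conj ((v : L2) x) * (u : L2) x)) := by
      filter_upwards [Lp.coeFn_smul a (u : L2)] with x hx
      rw [Submodule.coe_smul, hx, Pi.smul_apply, smul_eq_mul]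
      ring
    rw [Prod.smul_snd, inner_smul_right, ← hu', tForm, tForm, integral_congr_ae h,
      integral_const_mul, map_smul, Submodule.coe_smul, inner_smul_right, inner_smul_right]
    ring

/-- The self-adjoint operator `ℒ = ℒ₀ + |D|⁻¹ V` in `Ḣ^{1/2}(ℝ)` associated with the form `𝔱_V`:
its domain consists of the `u ∈ H¹(ℝ)` for which there is `w ∈ Ḣ^{1/2}(ℝ)` with
`𝔱_V[v, u] = ⟨v, w⟩` for all `v ∈ H¹(ℝ)`, and `ℒ u = w`. -/
def opL (b c : ℝ) (V : ℝ → ℝ) (hV : Integrable V) : HDot →ₗ.[ℂ] HDot :=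
  (opGraph b c V hV).toLinearPMap

/-- `(u, w)` is in the graph of `ℒ` if and only if it is in `opGraph`, as that set is the graph of
a function. -/
theorem graph_opL (b c : ℝ) (V : ℝ → ℝ) (hV : Integrable V) :
    (opL b c V hV).graph = opGraph b c V hV := by
  refine Submodule.toLinearPMap_graph_eq _ ?_
  rintro ⟨_, w⟩ ⟨u, hu, h⟩ rfl
  have hu0 : u = 0 := toHDot_injective (by rw [hu, map_zero])
  subst hu0
  have h0 : ∀ v : H1, tForm b c V v 0 = 0 := by
    intro v
    simp [tForm]
  refine Dense.eq_zero_of_inner_right (𝕜 := ℂ) denseRange_toHDot ?_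
  rintro _ ⟨v, rfl⟩
  rw [← h v, h0]

/-! ### Spectral projections -/

/-- A projection-valued measure on the Borel sets of `ℝ` in a Hilbert space `H`: its values are
orthogonal projections, `E(ℝ) = 1`, and it is countably additive in the strong operator
topology. -/
structure ProjectionMeasure (H : Type*) [NormedAddCommGroup H] [InnerProductSpace ℂ H]
    [CompleteSpace H] where
  /-- the projection `E(s)` -/
  proj : Set ℝ → H →L[ℂ] H
  isStarProjection : ∀ s, MeasurableSet s → IsStarProjection (proj s)
  univ : proj Set.univ = 1
  hasSum : ∀ f : ℕ → Set ℝ, (∀ n, MeasurableSet (f n)) → Pairwise (Function.onFun Disjoint f) →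
    ∀ x : H, HasSum (fun n ↦ proj (f n) x) (proj (⋃ n, f n) x)

namespace ProjectionMeasure

variable {H : Type*} [NormedAddCommGroup H] [InnerProductSpace ℂ H] [CompleteSpace H]

theorem inner_proj (E : ProjectionMeasure H) {s : Set ℝ} (hs : MeasurableSet s) (x : H) :
    RCLike.re (inner ℂ x (E.proj s x)) = ‖E.proj s x‖ ^ 2 := by
  have h := E.isStarProjection s hs
  have h1 : E.proj s x = E.proj s (E.proj s x) := by
    conv_lhs => rw [← h.isIdempotentElem.eq]
    rfl
  have h2 := (ContinuousLinearMap.isSelfAdjoint_iff_isSymmetric.mp h.isSelfAdjoint) x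
    (E.proj s x)
  rw [← inner_self_eq_norm_sq (𝕜 := ℂ)]
  congr 1
  rw [h1]
  simp only [ContinuousLinearMap.coe_coe] at h2
  rw [← h2, ← h1]

/-- The scalar spectral measure `μ_x(s) = ‖E(s) x‖² = ⟨x, E(s) x⟩`. -/
def measure (E : ProjectionMeasure H) (x : H) : Measure ℝ :=
  Measure.ofMeasurable (fun s _ ↦ ENNReal.ofReal (‖E.proj s x‖ ^ 2))
    (by
      have h := E.hasSum (fun _ ↦ ∅) (fun _ ↦ MeasurableSet.empty) (fun i j _ ↦ by simp) x
      have h0 : E.proj ∅ x = 0 := by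
        have := h.summable.tendsto_atTop_zero
        exact tendsto_nhds_unique tendsto_const_nhds this
      simp [h0])
    (by
      intro f hf hd
      have h := E.hasSum f hf hd x
      have h1 : HasSum (fun n ↦ ‖E.proj (f n) x‖ ^ 2) (‖E.proj (⋃ n, f n) x‖ ^ 2) := by
        rw [← E.inner_proj (MeasurableSet.iUnion hf) x]
        simp only [← fun n ↦ E.inner_proj (hf n) x]
        exact ((h.mapL (innerSL ℂ x)).mapL (RCLike.reCLM (K := ℂ)))
      rw [← h1.tsum_eq]
      exact ENNReal.ofReal_tsum_of_nonneg (fun n ↦ by positivity) h1.summable)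

theorem measure_apply (E : ProjectionMeasure H) (x : H) {s : Set ℝ} (hs : MeasurableSet s) :
    E.measure x s = ENNReal.ofReal (‖E.proj s x‖ ^ 2) :=
  Measure.ofMeasurable_apply s hs

/-- `E` is the spectral measure of the operator `A`, that is, `A = ∫ λ dE(λ)`: the domain of `A`
is `{x : ∫ λ² dμ_x(λ) < ∞}` and `⟨x, A x⟩ = ∫ λ dμ_x(λ)` for `x` in the domain. The spectral
projection `P_s(A)` is then `E(s)`. -/
def IsSpectralMeasureOf (E : ProjectionMeasure H) (A : H →ₗ.[ℂ] H) : Prop :=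
  (∀ x : H, x ∈ A.domain ↔ ∫⁻ t, ENNReal.ofReal (t ^ 2) ∂(E.measure x) < ∞) ∧
    ∀ x : A.domain, inner ℂ (x : H) (A x) = ((∫ t, t ∂(E.measure (x : H)) : ℝ) : ℂ)

end ProjectionMeasure

/-- The negative part `V₋ = (V - |V|) / 2`. -/
def negPart (V : ℝ → ℝ) (x : ℝ) : ℝ := (V x - |V x|) / 2

end HamiltonianKrein

end

noncomputable section

namespace HamiltonianKrein

/-! ### Self-adjointness of operators given by compactly perturbed forms -/

section Abstract

variable {G H : Type*} [NormedAddCommGroup G] [InnerProductSpace ℂ G] [CompleteSpace G]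
  [NormedAddCommGroup H] [InnerProductSpace ℂ H] [CompleteSpace H]

/-! With `m(ξ) = (b² + (2πcξ)²)^{1/2}`, the map `formMap : u ↦ m û` is a bijection from `H¹` onto
`L²` that turns the unperturbed form into the `L²` inner product (`inner_formMap`). Point evaluation
becomes `u(x) = ⟨k_x, m û⟩` with `‖k_x‖² = ∫ m⁻² = 1/(2bc)`, independent of `x`; this is where the
constant comes from. In these coordinates the full form is `⟨v, (1 + K) u⟩` with `K = ∫ V(x) ⟨k_x,
·⟩ k_x dx`, a norm-convergent integral of rank-one operators, hence compact and self-adjoint. The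
space `Ḣ^{1/2}` enters only through the bounded injective embedding `J = formEmbedding`.

Self-adjointness: solving `(T - z) x = w` for `z = ±i` amounts to solving `(1 + K - z J⋆J) u = J⋆w`.
Since `1 - z J⋆J` is invertible and `K` is compact, the Fredholm alternative reduces this to
injectivity, which follows by taking imaginary parts (`surjective_one_add_compact_sub`).

Bound: on the part of the spectral subspace for `(-∞,0]` that lies in the domain, the form is
nonpositive, so `‖u‖² ≤ ∫ |V₋(x)| |⟨k_x, u⟩|² dx`. Summing over an orthonormal basis of a
finite-dimensional subspace and applying Bessel's inequality to `k_x` gives dimension at most `∫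
|V₋| ‖k_x‖²` (`finrank_le_of_normSq_le`). This is a Birman–Schwinger trace bound that never mentions
eigenvalues. The domain part is dense in the spectral subspace
(`IsSpectralMeasureOf.range_proj_le_closure`) and, being finite-dimensional, is closed, so it is the
whole subspace. -/

/-- A symmetric operator `T` for which `T - i` and `T + i` are surjective is self-adjoint. -/
theorem isSelfAdjoint_of_isFormalAdjoint_of_surjective {T : H →ₗ.[ℂ] H}
    (hT : T.IsFormalAdjoint T)
    (hsurj : ∀ z : ℂ, z = Complex.I ∨ z = -Complex.I →
      ∀ w : H, ∃ x : T.domain, T x - z • (x : H) = w) :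
    IsSelfAdjoint T := by
  have hkey : ∀ z : ℂ, z = Complex.I ∨ z = -Complex.I → ∀ d : H,
      (∀ v : T.domain, inner ℂ d (T v - z • (v : H)) = 0) → d = 0 := by
    intro z hz d hd
    obtain ⟨v, hv⟩ := hsurj z hz d
    have := hd v
    rw [hv] at this
    exact inner_self_eq_zero.mp this
  -- Density is not assumed: if `w ⟂ dom T` and `w = (T - i) u`, symmetry gives `u ⟂ ran (T + i)`,
  -- which is everything, so `u = 0` and `w = 0`.
  have hdense : Dense (T.domain : Set H) := by
    rw [Submodule.dense_iff_topologicalClosure_eq_top,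
      Submodule.topologicalClosure_eq_top_iff, Submodule.eq_bot_iff]
    intro w hw
    obtain ⟨u, hu⟩ := hsurj Complex.I (Or.inl rfl) w
    have hu0 : (u : H) = 0 := by
      refine hkey (-Complex.I) (Or.inr rfl) _ fun v ↦ ?_
      have h1 : inner ℂ (v : H) w = 0 := (Submodule.mem_orthogonal _ _).mp hw v v.2
      rw [← hu, inner_sub_right, ← hT v u, inner_smul_right] at h1
      have h2 := congrArg conj h1
      rw [map_sub, map_mul, inner_conj_symm, inner_conj_symm, map_zero, Complex.conj_I] at h2
      rw [inner_sub_right, inner_smul_right]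
      exact h2
    have hu1 : u = 0 := Subtype.ext hu0
    rw [← hu, hu1]
    simp
  rw [LinearPMap.isSelfAdjoint_def]
  have hle : T ≤ T.adjoint := hT.le_adjoint hdense
  refine (LinearPMap.eq_of_le_of_domain_eq hle (le_antisymm hle.1 ?_)).symm
  intro y hy
  -- Choose `x ∈ dom T` with `(T - i) x = (T⋆ - i) y`; then `y - x` is orthogonal to `ran (T + i)`,
  -- so `y = x`.
  obtain ⟨x, hx⟩ := hsurj Complex.I (Or.inl rfl) (T.adjoint ⟨y, hy⟩ - Complex.I • y)
  have hd : y - x = 0 := by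
    refine hkey (-Complex.I) (Or.inr rfl) _ fun v ↦ ?_
    have h1 := LinearPMap.adjoint_isFormalAdjoint hdense ⟨y, hy⟩ v
    have h2 := hT x v
    have h3 : T.adjoint ⟨y, hy⟩ = T x - Complex.I • (x : H) + Complex.I • y := by
      rw [hx]; abel
    rw [h3] at h1
    simp only [inner_add_left, inner_sub_left, inner_smul_left, Complex.conj_I] at h1
    simp only [inner_sub_left, inner_sub_right, inner_smul_right]
    rw [← h2, ← h1]
    ring
  rw [sub_eq_zero.mp hd]
  exact x.2

/-- For a compact self-adjoint `K` and an injective bounded `J`, the operator `1 + K - z J⋆J` is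
surjective for non-real `z`. -/
theorem surjective_one_add_compact_sub {J : G →L[ℂ] H} (hJ : Function.Injective J)
    {K : G →L[ℂ] G} (hK : IsCompactOperator K) (hK' : IsSelfAdjoint K) {z : ℂ} (hz : z.im ≠ 0) :
    Function.Surjective fun u : G ↦ u + K u - z • (J.adjoint (J u)) := by
  set S : G →L[ℂ] G := J.adjoint ∘L J with hS
  have hSsa : IsSelfAdjoint S := by
    rw [ContinuousLinearMap.isSelfAdjoint_iff_isSymmetric]
    intro x y
    simp [hS, ContinuousLinearMap.adjoint_inner_left, ContinuousLinearMap.adjoint_inner_right]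
  have hz0 : z ≠ 0 := fun h ↦ hz (by simp [h])
  -- `1 - zS = z (z⁻¹ - S)`, and the non-real number `z⁻¹` is not in the spectrum of the
  -- self-adjoint `S`.
  have hu : IsUnit (1 - z • S) := by
    have h1 : z⁻¹ ∉ spectrum ℂ S := by
      intro h
      have h2 := hSsa.im_eq_zero_of_mem_spectrum h
      rw [Complex.inv_im, div_eq_zero_iff, neg_eq_zero] at h2
      exact h2.elim hz fun h3 ↦ hz0 (Complex.normSq_eq_zero.mp h3)
    have h2 := (spectrum.notMem_iff.mp h1)
    have h3 : 1 - z • S = z • (algebraMap ℂ (G →L[ℂ] G) z⁻¹ - S) := by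
      rw [smul_sub, Algebra.algebraMap_eq_smul_one, smul_smul, mul_inv_cancel₀ hz0, one_smul]
    rw [h3]
    exact h2.smul (Units.mk0 z hz0)
  obtain ⟨U, hU⟩ := hu
  set R : G →L[ℂ] G := ↑U⁻¹ with hR
  have hRU : ∀ x, (1 - z • S) (R x) = x := by
    intro x
    have : (U : G →L[ℂ] G) * R = 1 := U.mul_inv
    rw [hU] at this
    exact DFunLike.congr_fun this x
  have hRK : IsCompactOperator (R ∘L K) := hK.clm_comp R
  -- Pairing with `x`, the terms `‖x‖²` and `⟨x, Kx⟩` are real, so the imaginary part leaves `Im z ·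
  -- ‖Jx‖² = 0`.
  have hinj : ∀ x : G, x + K x - z • S x = 0 → x = 0 := by
    intro x hx
    have h1 := congrArg (inner ℂ x) hx
    have h2 : (inner ℂ x (S x) : ℂ) = ((‖J x‖ ^ 2 : ℝ) : ℂ) := by
      simp [hS, ContinuousLinearMap.adjoint_inner_right, inner_self_eq_norm_sq_to_K]
    have h3 : (inner ℂ x (K x) : ℂ).im = 0 := by
      have := (ContinuousLinearMap.isSelfAdjoint_iff_isSymmetric.mp hK') x x
      rw [← Complex.conj_eq_iff_im, inner_conj_symm]
      exact this
    rw [inner_sub_right, inner_add_right, inner_smul_right, h2, inner_zero_right] at h1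
    have h4 := congrArg Complex.im h1
    rw [Complex.sub_im, Complex.add_im, h3, Complex.im_mul_ofReal, inner_self_eq_norm_sq_to_K]
      at h4
    have h5 : z.im * ‖J x‖ ^ 2 = 0 := by
      have : (((‖x‖ : ℂ)) ^ 2).im = 0 := by rw [← Complex.ofReal_pow, Complex.ofReal_im]
      simpa [this] using h4
    have h6 : J x = 0 := by simpa [hz] using h5
    exact hJ (by rw [h6, map_zero])
  -- Fredholm alternative for the compact operator `RK`: an eigenvector for `-1` would be a kernel
  -- vector of `1 + K - zS`.
  have hres : (-1 : ℂ) ∈ resolventSet ℂ (R ∘L K) := by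
    refine (hRK.hasEigenvalue_or_mem_resolventSet (by norm_num)).resolve_left ?_
    intro h
    obtain ⟨x, hx⟩ := h.exists_hasEigenvector
    refine hx.2 (hinj x ?_)
    have h1 : R (K x) = -x := by simpa using hx.apply_eq_smul
    have h2 := hRU (K x)
    rw [h1] at h2
    rw [← h2]
    simp
  obtain ⟨W, hW⟩ := spectrum.mem_resolventSet_iff.mp hres
  intro y
  -- The unit `W` is `-1 - RK`, hence the sign.
  refine ⟨-((↑W⁻¹ : G →L[ℂ] G) (R y)), ?_⟩
  set x : G := (↑W⁻¹ : G →L[ℂ] G) (R y) with hx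
  have h1 : (W : G →L[ℂ] G) x = R y := by
    have : (W : G →L[ℂ] G) * (↑W⁻¹ : G →L[ℂ] G) = 1 := W.mul_inv
    exact DFunLike.congr_fun this (R y)
  rw [hW] at h1
  have h2 : -x - R (K x) = R y := by simpa using h1
  have h3 := congrArg (1 - z • S : G →L[ℂ] G) h2
  rw [map_sub, hRU, hRU] at h3
  rw [← h3]
  simp [hS]
  abel

/-- The operator associated with the form `⟨v, (1 + K) u⟩` in a space into which the form domain
`G` is embedded by `J` is self-adjoint. -/
theorem isSelfAdjoint_of_graph {J : G →L[ℂ] H} (hJ : Function.Injective J)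
    {K : G →L[ℂ] G} (hK : IsCompactOperator K) (hK' : IsSelfAdjoint K) {T : H →ₗ.[ℂ] H}
    (hT : ∀ p : H × H, p ∈ T.graph ↔
      ∃ u : G, J u = p.1 ∧ ∀ v : G, inner ℂ v (u + K u) = inner ℂ (J v) p.2) :
    IsSelfAdjoint T := by
  have hg : ∀ x : T.domain,
      ∃ u : G, J u = (x : H) ∧ ∀ v : G, inner ℂ v (u + K u) = inner ℂ (J v) (T x) :=
    fun x ↦ (hT (x, T x)).mp (T.mem_graph x)
  have hKs := ContinuousLinearMap.isSelfAdjoint_iff_isSymmetric.mp hK'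
  refine isSelfAdjoint_of_isFormalAdjoint_of_surjective ?_ ?_
  · intro x y
    obtain ⟨u, hu, hu'⟩ := hg x
    obtain ⟨v, hv, hv'⟩ := hg y
    rw [← hv, ← hu, ← hv', ← inner_conj_symm, ← hu', inner_conj_symm, inner_add_left,
      inner_add_right]
    congr 1
    exact hKs u v
  · intro z hz w
    have hz' : z.im ≠ 0 := by rcases hz with rfl | rfl <;> simp
    obtain ⟨u, hu⟩ := surjective_one_add_compact_sub hJ hK hK' hz' (J.adjoint w)
    have hmem : (J u, w + z • J u) ∈ T.graph := by
      refine (hT _).mpr ⟨u, rfl, fun v ↦ ?_⟩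
      have h1 : u + K u = J.adjoint (w + z • J u) := by
        rw [map_add, map_smul, ← hu]
        simp
      rw [h1, ContinuousLinearMap.adjoint_inner_right]
    obtain ⟨x, hx, hx'⟩ := T.mem_graph_iff.mp hmem
    refine ⟨x, ?_⟩
    rw [hx, hx']
    simp

end Abstract

/-! ### Spectral subspaces of projection-valued measures -/

namespace ProjectionMeasure

variable {H : Type*} [NormedAddCommGroup H] [InnerProductSpace ℂ H] [CompleteSpace H]
  (E : ProjectionMeasure H)

theorem proj_empty (x : H) : E.proj ∅ x = 0 := by
  have h := E.hasSum (fun _ ↦ ∅) (fun _ ↦ MeasurableSet.empty) (fun i j _ ↦ by simp) x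
  exact tendsto_nhds_unique tendsto_const_nhds h.summable.tendsto_atTop_zero

theorem measure_zero_iff {x : H} {s : Set ℝ} (hs : MeasurableSet s) :
    E.measure x s = 0 ↔ E.proj s x = 0 := by
  rw [E.measure_apply x hs, ENNReal.ofReal_eq_zero]
  constructor
  · intro h
    have : ‖E.proj s x‖ ^ 2 = 0 := le_antisymm h (sq_nonneg _)
    simpa using this
  · intro h
    simp [h]

instance isFiniteMeasure_measure (x : H) : IsFiniteMeasure (E.measure x) :=
  ⟨by rw [E.measure_apply x MeasurableSet.univ]; exact ENNReal.ofReal_lt_top⟩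

theorem proj_add_proj_compl {s : Set ℝ} (hs : MeasurableSet s) (x : H) :
    E.proj s x + E.proj sᶜ x = x := by
  -- Finite additivity from countable additivity: the two sets are padded with `∅`.
  let f : ℕ → Set ℝ := fun n ↦ if n = 0 then s else if n = 1 then sᶜ else ∅
  have hf : ∀ n, MeasurableSet (f n) := by
    intro n
    by_cases h0 : n = 0
    · simpa [f, h0] using hs
    · by_cases h1 : n = 1
      · simpa [f, h1] using hs.compl
      · simp [f, h0, h1]
  have hd : Pairwise (Function.onFun Disjoint f) := by
    intro m n hmn
    rw [Function.onFun, Set.disjoint_left]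
    intro a ha hb
    simp only [f] at ha hb
    split_ifs at ha hb <;> simp_all
  have hU : ⋃ n, f n = Set.univ := by
    refine Set.eq_univ_of_forall fun a ↦ ?_
    by_cases ha : a ∈ s
    · exact Set.mem_iUnion.mpr ⟨0, by simpa [f] using ha⟩
    · exact Set.mem_iUnion.mpr ⟨1, by simpa [f] using ha⟩
  have h := E.hasSum f hf hd x
  rw [hU, E.univ] at h
  have h2 := hasSum_sum_of_ne_finset_zero (L := SummationFilter.unconditional ℕ)
    (s := Finset.range 2) (f := fun n ↦ E.proj (f n) x) (by
    intro n hn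
    have : f n = ∅ := by
      simp only [Finset.mem_range, not_lt] at hn
      have h0 : n ≠ 0 := by omega
      have h1 : n ≠ 1 := by omega
      simp [f, h0, h1]
    simp only [this, E.proj_empty])
  have h3 := h2.unique h
  simpa [Finset.sum_range_succ, f] using h3

/-- By `E(s) + E(sᶜ) = 1`, lying in a spectral subspace is a support condition on the scalar
measure, so integrals against that measure can be estimated pointwise on `s`. -/
theorem mem_range_proj_iff {s : Set ℝ} (hs : MeasurableSet s) (x : H) :
    x ∈ LinearMap.range (E.proj s).toLinearMap ↔ E.measure x sᶜ = 0 := by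
  rw [E.measure_zero_iff hs.compl]
  constructor
  · rintro ⟨y, rfl⟩
    have h := E.proj_add_proj_compl hs (E.proj s y)
    have h1 : E.proj s (E.proj s y) = E.proj s y :=
      DFunLike.congr_fun (E.isStarProjection s hs).isIdempotentElem.eq y
    rw [h1] at h
    exact left_eq_add.mp h.symm
  · intro h
    refine ⟨x, ?_⟩
    have h1 := E.proj_add_proj_compl hs x
    rw [h, add_zero] at h1
    exact h1

theorem IsSpectralMeasureOf.re_inner_nonpos {E : ProjectionMeasure H} {A : H →ₗ.[ℂ] H}
    (hE : E.IsSpectralMeasureOf A) (x : A.domain)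
    (hx : (x : H) ∈ LinearMap.range (E.proj (Set.Iic 0)).toLinearMap) :
    RCLike.re (inner ℂ (x : H) (A x)) ≤ 0 := by
  rw [E.mem_range_proj_iff measurableSet_Iic] at hx
  rw [hE.2 x]
  refine (RCLike.ofReal_re (K := ℂ) _).le.trans (integral_nonpos_of_ae ?_)
  filter_upwards [measure_eq_zero_iff_ae_notMem.mp hx] with t ht
  simpa using ht

/-- A vector of the spectral subspace need not lie in the domain, as the spectrum is not known in
advance to be bounded below. Cutting `(-∞,0]` into bounded pieces approximates it by vectors whose
scalar measures have bounded support, and these have finite second moment. -/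
theorem IsSpectralMeasureOf.range_proj_le_closure {E : ProjectionMeasure H} {A : H →ₗ.[ℂ] H}
    (hE : E.IsSpectralMeasureOf A) :
    LinearMap.range (E.proj (Set.Iic 0)).toLinearMap ≤
      (LinearMap.range (E.proj (Set.Iic 0)).toLinearMap ⊓ A.domain).topologicalClosure := by
  rintro _ ⟨x, rfl⟩
  let f : ℕ → Set ℝ := fun n ↦ Set.Ioc (-((n : ℝ) + 1)) (-(n : ℝ))
  have hf : ∀ n, MeasurableSet (f n) := fun n ↦ measurableSet_Ioc
  have hd : Pairwise (Function.onFun Disjoint f) := by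
    have key : ∀ m n : ℕ, m < n → Disjoint (f m) (f n) := by
      intro m n h
      rw [Set.disjoint_left]
      intro a ha hb
      have h1 : (m : ℝ) + 1 ≤ n := by exact_mod_cast h
      linarith [ha.1, hb.2]
    intro m n hmn
    rcases lt_or_gt_of_ne hmn with h | h
    · exact key m n h
    · exact (key n m h).symm
  have hU : ⋃ n, f n = Set.Iic 0 := by
    ext a
    simp only [Set.mem_iUnion, f, Set.mem_Ioc, Set.mem_Iic]
    constructor
    · rintro ⟨n, -, h⟩
      exact h.trans (neg_nonpos.mpr n.cast_nonneg)
    · intro h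
      refine ⟨⌊-a⌋₊, ?_, ?_⟩
      · linarith [Nat.lt_floor_add_one (-a)]
      · linarith [Nat.floor_le (neg_nonneg.mpr h)]
  have h := E.hasSum f hf hd x
  rw [hU] at h
  refine (Submodule.isClosed_topologicalClosure _).mem_of_tendsto h
    (Filter.Eventually.of_forall fun F ↦ Submodule.le_topologicalClosure _ ?_)
  refine Submodule.sum_mem _ fun n _ ↦ ?_
  have h0 : E.measure (E.proj (f n) x) (f n)ᶜ = 0 :=
    (E.mem_range_proj_iff (hf n) _).mp ⟨x, rfl⟩
  refine ⟨(E.mem_range_proj_iff measurableSet_Iic _).mpr (measure_mono_null ?_ h0), ?_⟩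
  · rw [Set.compl_subset_compl, ← hU]
    exact Set.subset_iUnion f n
  · refine (hE.1 _).mpr ?_
    refine (lintegral_mono_ae (g := fun _ ↦ ENNReal.ofReal (((n : ℝ) + 1) ^ 2)) ?_).trans_lt ?_
    · filter_upwards [measure_eq_zero_iff_ae_notMem.mp h0] with t ht
      have ht' : t ∈ f n := by simpa using ht
      refine ENNReal.ofReal_le_ofReal (sq_le_sq' ht'.1.le ?_)
      have : (0 : ℝ) ≤ n := n.cast_nonneg
      linarith [ht'.2]
    · rw [lintegral_const]
      exact ENNReal.mul_lt_top ENNReal.ofReal_lt_top (measure_lt_top _ _)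

end ProjectionMeasure

/-! ### The potential as a compact operator, and the trace bound -/

section BirmanSchwinger

variable {G H : Type*} [NormedAddCommGroup G] [InnerProductSpace ℂ G] [CompleteSpace G]
  [NormedAddCommGroup H] [InnerProductSpace ℂ H] [CompleteSpace H]

/-- The operator `∫ V(x) ⟨k_x, ·⟩ k_x dx`. -/
def potentialOp (k : ℝ → G) (V : ℝ → ℝ) : G →L[ℂ] G :=
  ∫ x, (V x : ℂ) • InnerProductSpace.rankOne ℂ (k x) (k x)

variable {k : ℝ → G} {V : ℝ → ℝ} {κ : ℝ}

theorem integrable_potentialOp (hk : Continuous k) (hκ : ∀ x, ‖k x‖ ^ 2 = κ) (hV : Integrable V) :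
    Integrable fun x ↦ (V x : ℂ) • InnerProductSpace.rankOne ℂ (k x) (k x) := by
  have hc : Continuous fun x ↦ InnerProductSpace.rankOne ℂ (k x) (k x) :=
    (((ContinuousLinearMap.smulRightL ℂ G G).continuous.comp
      ((innerSL ℂ).continuous.comp hk))).clm_apply hk
  have hVm : AEStronglyMeasurable (fun x ↦ (V x : ℂ)) volume := hV.ofReal.1
  refine (hV.norm.mul_const κ).mono'
    (hVm.smul hc.aestronglyMeasurable) (Filter.Eventually.of_forall fun x ↦ ?_)
  rw [norm_smul, InnerProductSpace.norm_rankOne, ← hκ x, Complex.norm_real, sq]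

theorem isCompactOperator_potentialOp (hk : Continuous k) (hκ : ∀ x, ‖k x‖ ^ 2 = κ)
    (hV : Integrable V) : IsCompactOperator (potentialOp k V) := by
  set C : Submodule ℂ (G →L[ℂ] G) := compactOperator (RingHom.id ℂ) G G with hC
  have : IsClosed (C : Set (G →L[ℂ] G)) := isClosed_setOfPred_isCompactOperator
  have hmem : ∀ x, (V x : ℂ) • InnerProductSpace.rankOne ℂ (k x) (k x) ∈ C := by
    intro x
    refine C.smul_mem _ ?_
    change IsCompactOperator (InnerProductSpace.rankOne ℂ (k x) (k x))
    rw [InnerProductSpace.rankOne_def']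
    have hin : IsCompactOperator (innerSL ℂ (k x)) :=
      isCompactOperator_of_locallyCompactSpace_dom (innerSL ℂ (k x))
    exact hin.clm_comp (ContinuousLinearMap.toSpanSingleton ℂ (k x))
  have hint := integrable_potentialOp hk hκ hV
  -- The integrand takes values in the closed subspace `C` of compact operators, so the Bochner
  -- integral vanishes in the quotient by `C`.
  have h0 : C.mkQL (potentialOp k V) = 0 := by
    rw [potentialOp, ← ContinuousLinearMap.integral_comp_comm _ hint]
    refine integral_eq_zero_of_ae (Filter.Eventually.of_forall fun x ↦ ?_)
    exact (Submodule.Quotient.mk_eq_zero _).mpr (hmem x)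
  exact (Submodule.Quotient.mk_eq_zero C).mp h0

theorem inner_potentialOp (hk : Continuous k) (hκ : ∀ x, ‖k x‖ ^ 2 = κ) (hV : Integrable V)
    (v u : G) : inner ℂ v (potentialOp k V u) =
      ∫ x, (V x : ℂ) * (conj (inner ℂ (k x) v) * inner ℂ (k x) u) := by
  rw [potentialOp, ContinuousLinearMap.integral_apply (integrable_potentialOp hk hκ hV),
    ← integral_inner ((integrable_potentialOp hk hκ hV).apply_continuousLinearMap u)]
  refine integral_congr_ae (Filter.Eventually.of_forall fun x ↦ ?_)
  simp only [smul_apply, InnerProductSpace.rankOne_apply, inner_smul_right,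
    inner_conj_symm]
  ring

theorem isSelfAdjoint_potentialOp (hk : Continuous k) (hκ : ∀ x, ‖k x‖ ^ 2 = κ)
    (hV : Integrable V) : IsSelfAdjoint (potentialOp k V) := by
  rw [ContinuousLinearMap.isSelfAdjoint_iff_isSymmetric]
  intro v u
  rw [← inner_conj_symm]
  simp only [ContinuousLinearMap.coe_coe]
  rw [inner_potentialOp hk hκ hV, inner_potentialOp hk hκ hV, ← integral_conj]
  refine integral_congr_ae (Filter.Eventually.of_forall fun x ↦ ?_)
  simp only [map_mul, Complex.conj_conj, Complex.conj_ofReal]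
  ring

omit [CompleteSpace G] in
theorem integrable_mul_normSq_inner (hk : Continuous k) (hκ : ∀ x, ‖k x‖ ^ 2 = κ)
    (hV : Integrable V) (u : G) : Integrable fun x ↦ V x * ‖(inner ℂ (k x) u : ℂ)‖ ^ 2 := by
  have hc : Continuous fun x ↦ ‖(inner ℂ (k x) u : ℂ)‖ ^ 2 := by fun_prop
  refine hV.mul_bdd (c := κ * ‖u‖ ^ 2) hc.aestronglyMeasurable
    (Filter.Eventually.of_forall fun x ↦ ?_)
  rw [Real.norm_eq_abs, abs_of_nonneg (sq_nonneg _), ← hκ x, ← mul_pow]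
  gcongr
  exact norm_inner_le_norm _ _

omit [CompleteSpace G] in
/-- If `‖u‖² ≤ ∫ W(x) |⟨k_x, u⟩|² dx` on a finite-dimensional space `F`, where `W ≥ 0`,
then the dimension of `F` is at most `∫ W(x) ‖k_x‖² dx`. -/
theorem finrank_le_of_normSq_le (hk : Continuous k) (hκ : ∀ x, ‖k x‖ ^ 2 = κ) {W : ℝ → ℝ}
    (hW : Integrable W) (hW0 : ∀ x, 0 ≤ W x) (F : Submodule ℂ G) [FiniteDimensional ℂ F]
    (hF : ∀ u ∈ F, ‖u‖ ^ 2 ≤ ∫ x, W x * ‖(inner ℂ (k x) u : ℂ)‖ ^ 2) :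
    (Module.finrank ℂ F : ℝ) ≤ κ * ∫ x, W x := by
  set e := stdOrthonormalBasis ℂ F
  have he : Orthonormal ℂ fun i ↦ (e i : G) := e.orthonormal.comp_linearIsometry F.subtypeₗᵢ
  calc (Module.finrank ℂ F : ℝ) = ∑ i, ‖(e i : G)‖ ^ 2 := by simp [he.1]
    _ ≤ ∑ i, ∫ x, W x * ‖(inner ℂ (k x) (e i : G) : ℂ)‖ ^ 2 :=
        Finset.sum_le_sum fun i _ ↦ hF _ (e i).2
    _ = ∫ x, ∑ i, W x * ‖(inner ℂ (k x) (e i : G) : ℂ)‖ ^ 2 :=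
        (integral_finsetSum _ fun i _ ↦ integrable_mul_normSq_inner hk hκ hW _).symm
    _ ≤ ∫ x, κ * W x := by
        refine integral_mono
          (integrable_finsetSum _ fun i _ ↦ integrable_mul_normSq_inner hk hκ hW _)
          (hW.const_mul κ) fun x ↦ ?_
        simp only
        rw [← Finset.mul_sum, mul_comm κ, ← hκ x]
        refine mul_le_mul_of_nonneg_left ?_ (hW0 x)
        simp only [fun i ↦ norm_inner_symm (𝕜 := ℂ) (k x) (e i : G)]
        exact he.sum_inner_products_le (k x)
    _ = κ * ∫ x, W x := integral_const_mul _ _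

-- The finite-dimensional bound is uniform, so applying it to the span of each finite independent
-- family in `F` caps the size of such families; finiteness of the dimension follows instead of
-- being assumed.
omit [CompleteSpace G] in
theorem finiteDimensional_and_finrank_le_of_normSq_le (hk : Continuous k)
    (hκ : ∀ x, ‖k x‖ ^ 2 = κ) {W : ℝ → ℝ}
    (hW : Integrable W) (hW0 : ∀ x, 0 ≤ W x) (F : Submodule ℂ G)
    (hF : ∀ u ∈ F, ‖u‖ ^ 2 ≤ ∫ x, W x * ‖(inner ℂ (k x) u : ℂ)‖ ^ 2) :
    FiniteDimensional ℂ F ∧ (Module.finrank ℂ F : ℝ) ≤ κ * ∫ x, W x := by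
  have hfin : FiniteDimensional ℂ F := by
    have h : Module.rank ℂ F ≤ (⌊κ * ∫ x, W x⌋₊ : ℕ) := by
      refine rank_le fun s hs ↦ Nat.le_floor ?_
      have hs' : LinearIndependent ℂ fun i : s ↦ ((i : F) : G) :=
        hs.map' F.subtype (by simp)
      have hle : Submodule.span ℂ (Set.range fun i : s ↦ ((i : F) : G)) ≤ F := by
        rw [Submodule.span_le]
        rintro _ ⟨i, rfl⟩
        exact (i : F).2
      have hfd : FiniteDimensional ℂ (Submodule.span ℂ (Set.range fun i : s ↦ ((i : F) : G))) :=
        FiniteDimensional.span_of_finite ℂ (Set.finite_range _)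
      have := finrank_le_of_normSq_le hk hκ hW hW0 _ fun u hu ↦ hF u (hle hu)
      rwa [finrank_span_eq_card hs', Fintype.card_coe] at this
    exact Module.rank_lt_aleph0_iff.mp (h.trans_lt Cardinal.natCast_lt_aleph0)
  exact ⟨hfin, finrank_le_of_normSq_le hk hκ hW hW0 F hF⟩

/-- Self-adjointness and the Birman–Schwinger bound for the operator `T` associated with the form
`⟨v, u⟩ + ∫ V(x) ⟨v, k_x⟩ ⟨k_x, u⟩ dx`. -/
theorem isSelfAdjoint_and_finrank_le (hk : Continuous k) (hκ : ∀ x, ‖k x‖ ^ 2 = κ)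
    (hV : Integrable V) {J : G →L[ℂ] H} (hJ : Function.Injective J) {T : H →ₗ.[ℂ] H}
    (hT : ∀ p : H × H, p ∈ T.graph ↔ ∃ u : G, J u = p.1 ∧ ∀ v : G,
      inner ℂ v u + ∫ x, (V x : ℂ) * (conj (inner ℂ (k x) v) * inner ℂ (k x) u)
        = inner ℂ (J v) p.2) :
    IsSelfAdjoint T ∧ ∀ E : ProjectionMeasure H, E.IsSpectralMeasureOf T →
      FiniteDimensional ℂ (LinearMap.range (E.proj (Set.Iic 0)).toLinearMap) ∧
        (Module.finrank ℂ (LinearMap.range (E.proj (Set.Iic 0)).toLinearMap) : ℝ) ≤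
          κ * ∫ x, |negPart V x| := by
  have hT' : ∀ p : H × H, p ∈ T.graph ↔ ∃ u : G, J u = p.1 ∧ ∀ v : G,
      inner ℂ v (u + potentialOp k V u) = inner ℂ (J v) p.2 := by
    simpa only [inner_add_right, inner_potentialOp hk hκ hV] using hT
  refine ⟨isSelfAdjoint_of_graph hJ (isCompactOperator_potentialOp hk hκ hV)
    (isSelfAdjoint_potentialOp hk hκ hV) hT', fun E hE ↦ ?_⟩
  set P := LinearMap.range (E.proj (Set.Iic 0)).toLinearMap with hP
  have hW : Integrable fun x ↦ |negPart V x| := ((hV.sub hV.abs).div_const 2).abs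
  have hF : ∀ u ∈ (P ⊓ T.domain).comap J.toLinearMap,
      ‖u‖ ^ 2 ≤ ∫ x, |negPart V x| * ‖(inner ℂ (k x) u : ℂ)‖ ^ 2 := by
    intro u hu
    obtain ⟨huP, huT⟩ := hu
    obtain ⟨u', hu', h⟩ := (hT (J u, T ⟨J u, huT⟩)).mp (T.mem_graph ⟨J u, huT⟩)
    obtain rfl := hJ hu'
    have h1 := hE.re_inner_nonpos ⟨J u', huT⟩ huP
    simp only at h h1
    have h2 : (∫ x, (V x : ℂ) * (conj (inner ℂ (k x) u') * inner ℂ (k x) u'))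
        = ((∫ x, V x * ‖(inner ℂ (k x) u' : ℂ)‖ ^ 2 : ℝ) : ℂ) := by
      rw [← integral_complex_ofReal]
      refine integral_congr_ae (Filter.Eventually.of_forall fun x ↦ ?_)
      simp only
      rw [Complex.conj_mul']
      push_cast
      ring
    rw [← h u', h2, inner_self_eq_norm_sq_to_K] at h1
    have h3 : ‖u'‖ ^ 2 + ∫ x, V x * ‖(inner ℂ (k x) u' : ℂ)‖ ^ 2 ≤ 0 := by
      have e : ((‖u'‖ : ℂ)) ^ 2 + ((∫ x, V x * ‖(inner ℂ (k x) u' : ℂ)‖ ^ 2 : ℝ) : ℂ)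
        = ((‖u'‖ ^ 2 + ∫ x, V x * ‖(inner ℂ (k x) u' : ℂ)‖ ^ 2 : ℝ) : ℂ) := by push_cast; rfl
      have h4 : RCLike.re (((‖u'‖ ^ 2 + ∫ x, V x * ‖(inner ℂ (k x) u' : ℂ)‖ ^ 2 : ℝ) : ℂ)) ≤ 0 := by
        rw [← e]; exact h1
      simpa only [RCLike.re_to_complex, Complex.ofReal_re] using h4
    have h4 : -∫ x, V x * ‖(inner ℂ (k x) u' : ℂ)‖ ^ 2
        ≤ ∫ x, |negPart V x| * ‖(inner ℂ (k x) u' : ℂ)‖ ^ 2 := by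
      rw [← integral_neg]
      refine integral_mono (integrable_mul_normSq_inner hk hκ hV u').neg
        (integrable_mul_normSq_inner hk hκ hW u') fun x ↦ ?_
      simp only
      rw [← neg_mul]
      refine mul_le_mul_of_nonneg_right ?_ (sq_nonneg _)
      -- It suffices that `-V ≤ -V₋`, i.e. that the positive part of `V` is nonnegative.
      refine le_trans ?_ (neg_le_abs _)
      rw [negPart]
      linarith [neg_abs_le (V x), le_abs_self (V x)]
    linarith
  obtain ⟨hfin, hle⟩ := finiteDimensional_and_finrank_le_of_normSq_le hk hκ hW
    (fun x ↦ abs_nonneg _) _ hF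
  -- The operator domain lies in the range of `J`, so no dimension is lost in pulling back to the
  -- form domain.
  have hmap : ((P ⊓ T.domain).comap J.toLinearMap).map J.toLinearMap = P ⊓ T.domain := by
    rw [Submodule.map_comap_eq, inf_eq_right]
    intro x hx
    obtain ⟨u, hu, -⟩ := (hT (x, T ⟨x, hx.2⟩)).mp (T.mem_graph ⟨x, hx.2⟩)
    exact ⟨u, hu⟩
  have hfin' : FiniteDimensional ℂ (P ⊓ T.domain : Submodule ℂ H) := by
    rw [← hmap]; infer_instance
  have hPeq : P ⊓ T.domain = P := by
    refine le_antisymm inf_le_left (hE.range_proj_le_closure.trans ?_)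
    exact Submodule.topologicalClosure_minimal _ le_rfl (Submodule.closed_of_finiteDimensional _)
  rw [← hPeq]
  refine ⟨hfin', le_trans ?_ hle⟩
  have := Submodule.finrank_map_le J.toLinearMap ((P ⊓ T.domain).comap J.toLinearMap)
  rw [hmap] at this
  exact_mod_cast this

end BirmanSchwinger

/-! ### The symbol of the unperturbed form and its evaluation kernel -/

/-- The square root `(b² + c² λ²)^{1/2}`, `λ = 2πξ`, of the symbol of the form `𝔱₀`. -/
def formWeight (b c ξ : ℝ) : ℝ := Real.sqrt (b ^ 2 + (2 * Real.pi * c * ξ) ^ 2)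

theorem formWeight_sq (b c ξ : ℝ) : formWeight b c ξ ^ 2 = b ^ 2 + (2 * Real.pi * c * ξ) ^ 2 :=
  Real.sq_sqrt (by positivity)

theorem formWeight_nonneg (b c ξ : ℝ) : 0 ≤ formWeight b c ξ := Real.sqrt_nonneg _

theorem continuous_formWeight (b c : ℝ) : Continuous (formWeight b c) := by
  unfold formWeight
  fun_prop

theorem formWeight_pos {b : ℝ} (hb : 0 < b) (c ξ : ℝ) : 0 < formWeight b c ξ :=
  Real.sqrt_pos.mpr (by positivity)

/-- Factoring out `b²` and rescaling by `2πc/b` leaves `∫ (1 + y²)⁻¹ = π`, so the value is `b⁻² ·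
b/(2πc) · π`. -/
theorem integral_inv_formWeight_sq {b c : ℝ} (hb : 0 < b) (hc : 0 < c) :
    Integrable (fun ξ ↦ (formWeight b c ξ ^ 2)⁻¹) ∧
      ∫ ξ, (formWeight b c ξ ^ 2)⁻¹ = 1 / (2 * b * c) := by
  have ha : 2 * Real.pi * c / b ≠ 0 := by positivity
  have h : (fun ξ ↦ (formWeight b c ξ ^ 2)⁻¹)
      = fun ξ ↦ (b ^ 2)⁻¹ * (1 + (2 * Real.pi * c / b * ξ) ^ 2)⁻¹ := by
    funext ξ
    rw [formWeight_sq, ← mul_inv]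
    congr 1
    field_simp
  rw [h]
  refine ⟨(integrable_inv_one_add_sq.comp_mul_left' ha).const_mul _, ?_⟩
  rw [integral_const_mul, Measure.integral_comp_mul_left (fun y ↦ (1 + y ^ 2)⁻¹),
    integral_univ_inv_one_add_sq, abs_of_pos (by positivity), smul_eq_mul]
  field_simp

/-- The function `ξ ↦ e^{-2πixξ} / (b² + c² λ²)^{1/2}`, `λ = 2πξ`. -/
def evalKernelFun (b c x ξ : ℝ) : ℂ := (Real.fourierChar (-(x * ξ)) : ℂ) * (formWeight b c ξ : ℂ)⁻¹

theorem norm_evalKernelFun (b c x ξ : ℝ) : ‖evalKernelFun b c x ξ‖ = (formWeight b c ξ)⁻¹ := by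
  rw [evalKernelFun, norm_mul, Circle.norm_coe, one_mul, norm_inv, Complex.norm_real,
    Real.norm_eq_abs, abs_of_nonneg (formWeight_nonneg b c ξ)]

theorem continuous_evalKernelFun {b : ℝ} (hb : 0 < b) (c : ℝ) :
    Continuous fun p : ℝ × ℝ ↦ evalKernelFun b c p.1 p.2 := by
  unfold evalKernelFun
  refine Continuous.mul ?_ (Continuous.inv₀ ?_ fun p ↦ ?_)
  · have := Real.continuous_fourierChar
    fun_prop
  · exact Complex.continuous_ofReal.comp ((continuous_formWeight b c).comp continuous_snd)
  · exact_mod_cast (formWeight_pos hb c p.2).ne'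

theorem memLp_evalKernelFun {b c : ℝ} (hb : 0 < b) (hc : 0 < c) (x : ℝ) :
    MemLp (evalKernelFun b c x) 2 volume := by
  have hm : AEStronglyMeasurable (evalKernelFun b c x) volume :=
    ((continuous_evalKernelFun hb c).comp (Continuous.prodMk_right x)).aestronglyMeasurable
  rw [memLp_two_iff_integrable_sq_norm hm]
  simpa only [norm_evalKernelFun, inv_pow] using (integral_inv_formWeight_sq hb hc).1

/-- The element `k_x` of `L²(ℝ)` for which `⟨k_x, (b² + c² λ²)^{1/2} û⟩ = u(x)`. -/
def evalKernel {b c : ℝ} (hb : 0 < b) (hc : 0 < c) (x : ℝ) : L2 :=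
  (memLp_evalKernelFun hb hc x).toLp _

theorem inner_evalKernel {b c : ℝ} (hb : 0 < b) (hc : 0 < c) (x : ℝ) (f : L2) :
    inner ℂ (evalKernel hb hc x) f = ∫ ξ, conj (evalKernelFun b c x ξ) * f ξ := by
  rw [L2.inner_def]
  refine integral_congr_ae ?_
  filter_upwards [(memLp_evalKernelFun hb hc x).coeFn_toLp] with ξ h
  rw [evalKernel, h, RCLike.inner_apply, mul_comm]

theorem norm_sq_evalKernel {b c : ℝ} (hb : 0 < b) (hc : 0 < c) (x : ℝ) :
    ‖evalKernel hb hc x‖ ^ 2 = 1 / (2 * b * c) := by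
  have h : (inner ℂ (evalKernel hb hc x) (evalKernel hb hc x) : ℂ)
      = ((1 / (2 * b * c) : ℝ) : ℂ) := by
    rw [inner_evalKernel, ← (integral_inv_formWeight_sq hb hc).2, ← integral_complex_ofReal]
    refine integral_congr_ae ?_
    filter_upwards [(memLp_evalKernelFun hb hc x).coeFn_toLp] with ξ h
    rw [evalKernel, h, Complex.conj_mul', norm_evalKernelFun]
    push_cast
    rw [inv_pow]
  rw [inner_self_eq_norm_sq_to_K] at h
  refine Complex.ofReal_injective (Eq.trans ?_ h)
  rw [Complex.ofReal_pow]
  rfl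

/-- Since `‖k_x‖` is constant, norm continuity reduces to continuity of `x ↦ ⟨k_x, k_y⟩`, which is
dominated convergence with majorant `m⁻²`. -/
theorem continuous_evalKernel {b c : ℝ} (hb : 0 < b) (hc : 0 < c) :
    Continuous (evalKernel hb hc) := by
  rw [continuous_iff_continuousAt]
  intro y
  have hin : Continuous fun x ↦ (inner ℂ (evalKernel hb hc x) (evalKernel hb hc y) : ℂ) := by
    simp only [inner_evalKernel]
    have hK := continuous_evalKernelFun hb c
    refine continuous_of_dominated (bound := fun ξ ↦ (formWeight b c ξ ^ 2)⁻¹) ?_ ?_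
      (integral_inv_formWeight_sq hb hc).1 ?_
    · intro x
      exact ((Complex.continuous_conj.comp
        (hK.comp (Continuous.prodMk_right x))).aestronglyMeasurable).mul
          (Lp.aestronglyMeasurable _)
    · intro x
      filter_upwards [(memLp_evalKernelFun hb hc y).coeFn_toLp] with ξ h
      rw [evalKernel, h, norm_mul, RCLike.norm_conj, norm_evalKernelFun, norm_evalKernelFun,
        ← mul_inv, sq]
    · refine Filter.Eventually.of_forall fun ξ ↦ ?_
      exact (Complex.continuous_conj.comp (hK.comp (Continuous.prodMk_left ξ))).mul
        continuous_const
  rw [ContinuousAt, tendsto_iff_norm_sub_tendsto_zero]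
  have h2 : Filter.Tendsto (fun x ↦ ‖evalKernel hb hc x - evalKernel hb hc y‖ ^ 2) (nhds y)
      (nhds 0) := by
    have h3 : Continuous fun x ↦ ‖evalKernel hb hc x - evalKernel hb hc y‖ ^ 2 := by
      have h4 : ∀ x, ‖evalKernel hb hc x - evalKernel hb hc y‖ ^ 2 = 1 / (2 * b * c)
          - 2 * RCLike.re (inner ℂ (evalKernel hb hc x) (evalKernel hb hc y) : ℂ)
          + 1 / (2 * b * c) := by
        intro x
        rw [@norm_sub_sq ℂ, norm_sq_evalKernel, norm_sq_evalKernel]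
      simp only [h4]
      have := RCLike.continuous_re.comp hin
      exact (continuous_const.sub (continuous_const.mul this)).add continuous_const
    simpa using h3.tendsto y
  have h3 := (Real.continuous_sqrt.tendsto _).comp h2
  simpa [Function.comp_def, Real.sqrt_sq (norm_nonneg _)] using h3

/-! ### Functions with integrable Fourier transform -/

/-- Fourier inversion by duality: both sides have the same integral against every smooth compactly
supported function, by moving the transform across the pairing. The reflection `ξ ↦ -ξ` converts the
inverse transform into the forward one. -/
theorem coeFn_ae_eq_fourierInv {u : L2} (hL1 : Integrable ((𝓕 u : L2) : ℝ → ℂ)) :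
    (u : ℝ → ℂ) =ᵐ[volume] 𝓕⁻ ((𝓕 u : L2) : ℝ → ℂ) := by
  set w : L2 := 𝓕 u with hw'
  have hneg : Integrable (fun ξ ↦ w (-ξ)) volume := hL1.comp_neg
  have hflip : 𝓕⁻ (w : ℝ → ℂ) = 𝓕 (fun ξ ↦ w (-ξ)) := Real.fourierInv_eq_fourier_comp_neg _
  have hcont : Continuous (𝓕⁻ (w : ℝ → ℂ)) := by
    rw [hflip]
    exact VectorFourier.fourierIntegral_continuous Real.continuous_fourierChar
      (L := innerₗ ℝ) continuous_inner hneg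
  refine ae_eq_of_integral_contDiff_smul_eq
    ((Lp.memLp u).locallyIntegrable (by norm_num)) hcont.locallyIntegrable ?_
  intro φ φ_smooth φ_cpt
  have h₁ : HasCompactSupport (Complex.ofRealCLM ∘ φ) := φ_cpt.comp_left rfl
  have h₂ : ContDiff ℝ (⊤ : ℕ∞) (Complex.ofRealCLM ∘ φ) := by fun_prop
  set ψ : 𝓢(ℝ, ℂ) := h₁.toSchwartzMap h₂ with hψ
  have hψx : ∀ x, ψ x = (φ x : ℂ) := fun x ↦ rfl
  have e1 : (u : 𝓢'(ℝ, ℂ)) ψ = ((w : L2) : 𝓢'(ℝ, ℂ)) (𝓕⁻ ψ) := by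
    rw [hw', ← Lp.fourier_toTemperedDistribution_eq, TemperedDistribution.fourier_apply,
      FourierTransform.fourier_fourierInv_eq]
  have e2 : ∫ ξ, 𝓕 (ψ : ℝ → ℂ) ξ • w (-ξ) = ∫ x, ψ x • 𝓕 (fun ξ ↦ w (-ξ)) x := by
    simpa using! VectorFourier.integral_fourierIntegral_smul_eq_flip (L := innerₗ ℝ)
      Real.continuous_fourierChar continuous_inner ψ.integrable hneg
  rw [Lp.toTemperedDistribution_apply, Lp.toTemperedDistribution_apply] at e1
  have e3 : ∫ ξ, (𝓕⁻ ψ) ξ • w ξ = ∫ ξ, 𝓕 (ψ : ℝ → ℂ) ξ • w (-ξ) := by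
    rw [← integral_neg_eq_self (fun ξ ↦ 𝓕 (ψ : ℝ → ℂ) ξ • w (-ξ))]
    refine integral_congr_ae (Filter.Eventually.of_forall fun ξ ↦ ?_)
    simp only [neg_neg]
    rw [SchwartzMap.fourierInv_coe, Real.fourierInv_eq_fourier_neg]
  have e4 := e1.trans (e3.trans e2)
  rw [← hflip] at e4
  simpa [hψx] using e4

/-! ### Diagonalization of the unperturbed form -/

theorem one_add_sq_rpow_eq_sqrt (ξ : ℝ) :
    (1 + ‖ξ‖ ^ 2) ^ ((1 : ℝ) / 2) = Real.sqrt (1 + ξ ^ 2) := by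
  rw [← Real.sqrt_eq_rpow, Real.norm_eq_abs, sq_abs]

theorem memLp_formWeight_mul (b c : ℝ) (u : H1) :
    MemLp (fun ξ ↦ (formWeight b c ξ : ℂ) * (𝓕 (u : L2) : L2) ξ) 2 volume := by
  obtain ⟨g, hg⟩ := exists_fourier_eq u
  refine MemLp.of_le_mul (c := Real.sqrt (b ^ 2 + (2 * Real.pi * c) ^ 2)) (Lp.memLp g) ?_ ?_
  · exact (Complex.continuous_ofReal.comp (continuous_formWeight b c)).aestronglyMeasurable.mul
      (Lp.aestronglyMeasurable _)
  · filter_upwards [hg] with ξ h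
    rw [h, norm_mul, norm_mul, ← mul_assoc, Complex.norm_real, Complex.norm_real,
      Real.norm_of_nonneg (formWeight_nonneg b c ξ), Real.norm_of_nonneg (besselWeight_nonneg ξ)]
    refine mul_le_mul_of_nonneg_right ?_ (norm_nonneg _)
    refine Real.le_sqrt_of_sq_le ?_
    rw [mul_pow, formWeight_sq, besselWeight_sq, ← div_eq_mul_inv, div_le_iff₀ (by positivity)]
    nlinarith [mul_nonneg (sq_nonneg b) (sq_nonneg ξ), sq_nonneg (2 * Real.pi * c)]

/-- The map `u ↦ (b² + c² λ²)^{1/2} û` from `H¹(ℝ)` to `L²(ℝ)`. -/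
def formMap (b c : ℝ) : H1 →ₗ[ℂ] L2 where
  toFun u := (memLp_formWeight_mul b c u).toLp _
  map_add' u v := by
    rw [← MemLp.toLp_add]
    refine MemLp.toLp_congr _ _ ?_
    rw [Submodule.coe_add, FourierTransform.fourier_add]
    filter_upwards [Lp.coeFn_add (𝓕 (u : L2) : L2) (𝓕 (v : L2) : L2)] with ξ h
    simp only [Pi.add_apply, h, mul_add]
  map_smul' a u := by
    rw [RingHom.id_apply, ← MemLp.toLp_const_smul]
    refine MemLp.toLp_congr _ _ ?_
    rw [Submodule.coe_smul, FourierTransform.fourier_smul]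
    filter_upwards [Lp.coeFn_smul a (𝓕 (u : L2) : L2)] with ξ h
    simp [h]
    ring

theorem coeFn_formMap (b c : ℝ) (u : H1) :
    (formMap b c u : ℝ → ℂ) =ᵐ[volume] fun ξ ↦ (formWeight b c ξ : ℂ) * (𝓕 (u : L2) : L2) ξ :=
  (memLp_formWeight_mul b c u).coeFn_toLp

theorem formMap_bijective {b c : ℝ} (hb : 0 < b) (hc : 0 < c) :
    Function.Bijective (formMap b c) := by
  have hne : ∀ ξ, (formWeight b c ξ : ℂ) ≠ 0 := fun ξ ↦ by
    exact_mod_cast (formWeight_pos hb c ξ).ne'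
  have hinv : Continuous fun ξ ↦ (formWeight b c ξ : ℂ)⁻¹ :=
    (Complex.continuous_ofReal.comp (continuous_formWeight b c)).inv₀ hne
  constructor
  · refine (injective_iff_map_eq_zero (formMap b c)).mpr fun u hu ↦ Subtype.ext ?_
    refine (Lp.fourierTransformₗᵢ ℝ ℂ).map_eq_zero_iff.mp ?_
    change (𝓕 (u : L2) : L2) = 0
    rw [Lp.eq_zero_iff_ae_eq_zero]
    filter_upwards [coeFn_formMap b c u, Lp.eq_zero_iff_ae_eq_zero.mp hu] with ξ h1 h2
    rw [h1] at h2
    simpa [hne] using h2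
  -- The preimage is `𝓕⁻¹(f/m)`; it lies in `H¹` because `(1 + ξ²)/m² ≤ b⁻² + (2πc)⁻²`.
  · intro f
    have hF : MemLp (fun ξ ↦ (formWeight b c ξ : ℂ)⁻¹ * f ξ) 2 volume := by
      refine MemLp.of_le_mul (c := b⁻¹) (Lp.memLp f)
        (hinv.aestronglyMeasurable.mul (Lp.aestronglyMeasurable _)) ?_
      refine Filter.Eventually.of_forall fun ξ ↦ ?_
      rw [norm_mul, norm_inv, Complex.norm_real, Real.norm_of_nonneg (formWeight_nonneg b c ξ)]
      refine mul_le_mul_of_nonneg_right (inv_anti₀ hb ?_) (norm_nonneg _)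
      exact Real.le_sqrt_of_sq_le (by nlinarith [sq_nonneg (2 * Real.pi * c * ξ)])
    set C : ℝ := Real.sqrt ((b ^ 2)⁻¹ + ((2 * Real.pi * c) ^ 2)⁻¹) with hC
    have hg : MemLp (fun ξ ↦ (((1 + ‖ξ‖ ^ 2) ^ ((1 : ℝ) / 2) : ℝ) : ℂ)
        * ((formWeight b c ξ : ℂ)⁻¹ * f ξ)) 2 volume := by
      refine MemLp.of_le_mul (c := C) (Lp.memLp f) ?_ ?_
      · refine AEStronglyMeasurable.mul ?_ hF.1
        refine Continuous.aestronglyMeasurable (Complex.continuous_ofReal.comp ?_)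
        exact Continuous.rpow_const (by fun_prop) (fun x ↦ Or.inr (by norm_num))
      · refine Filter.Eventually.of_forall fun ξ ↦ ?_
        rw [one_add_sq_rpow_eq_sqrt, norm_mul, norm_mul, norm_inv, Complex.norm_real,
          Complex.norm_real, Real.norm_of_nonneg (formWeight_nonneg b c ξ),
          Real.norm_of_nonneg (Real.sqrt_nonneg _), ← mul_assoc]
        refine mul_le_mul_of_nonneg_right ?_ (norm_nonneg _)
        rw [hC]
        refine Real.le_sqrt_of_sq_le ?_
        rw [mul_pow, inv_pow, formWeight_sq, Real.sq_sqrt (by positivity), ← div_eq_mul_inv,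
          div_le_iff₀ (by positivity)]
        have h1 : (b ^ 2)⁻¹ * b ^ 2 = 1 := inv_mul_cancel₀ (by positivity)
        have h2 : ((2 * Real.pi * c) ^ 2)⁻¹ * (2 * Real.pi * c * ξ) ^ 2 = ξ ^ 2 := by
          field_simp
        have h3 : 0 ≤ (b ^ 2)⁻¹ * (2 * Real.pi * c * ξ) ^ 2 := by positivity
        have h4 : 0 ≤ ((2 * Real.pi * c) ^ 2)⁻¹ * b ^ 2 := by positivity
        rw [add_mul, mul_add, mul_add, h1, h2]
        linarith
    have hfun : (𝓕 (𝓕⁻ (hF.toLp _) : L2) : L2) = hF.toLp _ :=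
      FourierTransform.fourier_fourierInv_eq _
    have hmem : (𝓕⁻ (hF.toLp _) : L2) ∈ H1 := by
      refine mem_H1_of_fourier _ (hg.toLp _) ?_
      rw [hfun]
      filter_upwards [hg.coeFn_toLp, hF.coeFn_toLp] with ξ h1 h2
      rw [h1, h2]
    refine ⟨⟨_, hmem⟩, Lp.ext ?_⟩
    filter_upwards [coeFn_formMap b c ⟨_, hmem⟩, hF.coeFn_toLp] with ξ h1 h2
    rw [h1, hfun, h2, mul_inv_cancel_left₀ (hne ξ)]

/-- Pointwise AM-GM: `2bc · 2π|ξ| ≤ b² + (2πcξ)²`. -/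
theorem norm_toHDot_le {b c : ℝ} (hb : 0 < b) (hc : 0 < c) (u : H1) :
    ‖toHDot u‖ ≤ Real.sqrt (1 / (2 * b * c)) * ‖formMap b c u‖ := by
  have h1 : ‖toHDot u‖ = ‖(MemLp.toLp _ (H1_le_hHalf u.2) : L2)‖ :=
    UniformSpace.Completion.norm_coe _
  rw [h1]
  refine Lp.norm_le_mul_norm_of_ae_le_mul ?_
  filter_upwards [MemLp.coeFn_toLp (H1_le_hHalf u.2), coeFn_formMap b c u] with ξ h2 h3
  rw [h2, h3, norm_mul, norm_mul, ← mul_assoc, Complex.norm_real, Complex.norm_real,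
    Real.norm_of_nonneg (formWeight_nonneg b c ξ), halfWeight,
    Real.norm_of_nonneg (Real.sqrt_nonneg _), formWeight,
    ← Real.sqrt_mul (by positivity)]
  refine mul_le_mul_of_nonneg_right (Real.sqrt_le_sqrt ?_) (norm_nonneg _)
  rw [one_div, ← div_eq_inv_mul, le_div_iff₀ (by positivity), mul_pow _ ξ, ← sq_abs ξ]
  nlinarith [sq_nonneg (b - 2 * Real.pi * c * |ξ|)]

theorem coeFn_fourier_weakDeriv (u : H1) : ((𝓕 (weakDeriv u) : L2) : ℝ → ℂ) =ᵐ[volume]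
    fun ξ ↦ (2 * Real.pi * Complex.I * ξ) * (𝓕 (u : L2) : L2) ξ := by
  have hm : MemLp (fun ξ : ℝ ↦ (2 * Real.pi * Complex.I * ξ) * (𝓕 (u : L2) : L2) ξ) 2 volume := by
    refine MemLp.of_le_mul (c := 1) (Lp.memLp (formMap 1 1 u)) ?_ ?_
    · have hcont : Continuous fun ξ : ℝ ↦ (2 * Real.pi * Complex.I * ξ : ℂ) := by fun_prop
      exact hcont.aestronglyMeasurable.mul (Lp.aestronglyMeasurable _)
    · filter_upwards [coeFn_formMap 1 1 u] with ξ h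
      rw [h, one_mul, norm_mul _ ((𝓕 (u : L2) : L2) ξ), norm_mul _ ((𝓕 (u : L2) : L2) ξ)]
      refine mul_le_mul_of_nonneg_right ?_ (norm_nonneg _)
      rw [Complex.norm_real, Real.norm_of_nonneg (formWeight_nonneg 1 1 ξ)]
      refine Real.le_sqrt_of_sq_le ?_
      simp [mul_pow]
  suffices h : (𝓕 (weakDeriv u) : L2) = hm.toLp _ by
    rw [h]
    exact hm.coeFn_toLp
  apply toTempered_injective
  rw [← Lp.fourier_toTemperedDistribution_eq, ← weakDeriv_spec, fourier_lineDerivOp_eq,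
    Lp.fourier_toTemperedDistribution_eq]
  ext φ
  have ht : (fun ξ : ℝ ↦ ((inner ℝ ξ (1 : ℝ) : ℝ) : ℂ)).HasTemperateGrowth := by fun_prop
  change (2 * Real.pi * Complex.I : ℂ) • (smulLeftCLM ℂ (fun ξ : ℝ ↦ ((inner ℝ ξ (1 : ℝ) : ℝ) : ℂ))
    ((𝓕 (u : L2) : L2) : 𝓢'(ℝ, ℂ))) φ = _
  rw [smulLeftCLM_apply_apply, Lp.toTemperedDistribution_apply, Lp.toTemperedDistribution_apply,
    ← integral_smul]
  refine integral_congr_ae ?_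
  filter_upwards [hm.coeFn_toLp] with ξ hξ
  rw [hξ, SchwartzMap.smulLeftCLM_apply_apply ht]
  simp only [smul_eq_mul, RCLike.inner_apply, conj_trivial, one_mul]
  ring

/-- Plancherel together with `m² = b² + (2πcξ)²`. -/
theorem inner_formMap (b c : ℝ) (v u : H1) : inner ℂ (formMap b c v) (formMap b c u) =
    (c : ℂ) ^ 2 * inner ℂ (weakDeriv v) (weakDeriv u)
      + (b : ℂ) ^ 2 * inner ℂ (v : L2) (u : L2) := by
  have hF : ∀ f g : L2, (inner ℂ f g : ℂ) = inner ℂ (𝓕 f : L2) (𝓕 g : L2) :=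
    fun f g ↦ ((Lp.fourierTransformₗᵢ ℝ ℂ).inner_map_map f g).symm
  rw [hF (weakDeriv v), hF (v : L2), L2.inner_def, L2.inner_def, L2.inner_def,
    ← integral_const_mul, ← integral_const_mul,
    ← integral_add ((L2.integrable_inner _ _).const_mul _) ((L2.integrable_inner _ _).const_mul _)]
  refine integral_congr_ae ?_
  filter_upwards [coeFn_formMap b c v, coeFn_formMap b c u, coeFn_fourier_weakDeriv v,
    coeFn_fourier_weakDeriv u] with ξ h1 h2 h3 h4
  rw [h1, h2, h3, h4]
  simp only [RCLike.inner_apply, map_mul, Complex.conj_ofReal, Complex.conj_I, map_ofNat]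
  have h5 : (formWeight b c ξ : ℂ) * (formWeight b c ξ : ℂ)
      = (b : ℂ) ^ 2 + (2 * Real.pi * c * ξ) ^ 2 := by
    rw [← sq]
    exact_mod_cast formWeight_sq b c ξ
  linear_combination (𝓕 (u : L2) : L2) ξ * conj ((𝓕 (v : L2) : L2) ξ) * h5
    + (c : ℂ) ^ 2 * (2 * Real.pi * ξ) ^ 2 * (𝓕 (u : L2) : L2) ξ * conj ((𝓕 (v : L2) : L2) ξ)
      * Complex.I_sq

theorem coeFn_ae_eq_inner_evalKernel {b c : ℝ} (hb : 0 < b) (hc : 0 < c) (u : H1) :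
    ((u : L2) : ℝ → ℂ) =ᵐ[volume] fun x ↦ inner ℂ (evalKernel hb hc x) (formMap b c u) := by
  have hne : ∀ ξ, (formWeight b c ξ : ℂ) ≠ 0 := fun ξ ↦ by
    exact_mod_cast (formWeight_pos hb c ξ).ne'
  have heq : ∀ x, (fun ξ ↦ conj (evalKernelFun b c x ξ) * formMap b c u ξ) =ᵐ[volume]
      fun ξ ↦ (Real.fourierChar (ξ * x) : ℂ) * (𝓕 (u : L2) : L2) ξ := by
    intro x
    filter_upwards [coeFn_formMap b c u] with ξ h
    rw [h, evalKernelFun, map_mul, map_inv₀, Complex.conj_ofReal, AddChar.map_neg_eq_inv,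
      Circle.coe_inv_eq_conj, Complex.conj_conj, mul_assoc, inv_mul_cancel_left₀ (hne ξ),
      mul_comm x]
  have hL1 : Integrable ((𝓕 (u : L2) : L2) : ℝ → ℂ) := by
    -- At `x = 0` the character is `1`, which exhibits `û` as the product of the `L²` functions
    -- `1/m` and `m û`.
    refine (((memLp_evalKernelFun hb hc 0).star).integrable_mul
      (Lp.memLp (formMap b c u))).congr ?_
    refine (heq 0).trans (Filter.Eventually.of_forall fun ξ ↦ ?_)
    simp
  filter_upwards [coeFn_ae_eq_fourierInv hL1] with x hx
  rw [hx, inner_evalKernel, integral_congr_ae (heq x), Real.fourierInv_eq]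
  refine integral_congr_ae (Filter.Eventually.of_forall fun ξ ↦ ?_)
  simp [Circle.smul_def, mul_comm]

theorem tForm_eq {b c : ℝ} (hb : 0 < b) (hc : 0 < c) (V : ℝ → ℝ) (v u : H1) :
    tForm b c V v u = inner ℂ (formMap b c v) (formMap b c u)
      + ∫ x, (V x : ℂ) * (conj (inner ℂ (evalKernel hb hc x) (formMap b c v))
        * inner ℂ (evalKernel hb hc x) (formMap b c u)) := by
  rw [tForm, inner_formMap]
  congr 1
  refine integral_congr_ae ?_
  filter_upwards [coeFn_ae_eq_inner_evalKernel hb hc v,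
    coeFn_ae_eq_inner_evalKernel hb hc u] with x h1 h2
  rw [h1, h2]

/-- The embedding of `H¹(ℝ)`, identified with `L²(ℝ)` by `formMap`, into `Ḣ^{1/2}(ℝ)`. -/
def formEmbedding {b c : ℝ} (hb : 0 < b) (hc : 0 < c) : L2 →L[ℂ] HDot :=
  (toHDot ∘ₗ (LinearEquiv.ofBijective _ (formMap_bijective hb hc)).symm.toLinearMap).mkContinuous
    (Real.sqrt (1 / (2 * b * c))) (by
      intro f
      obtain ⟨u, rfl⟩ := (LinearEquiv.ofBijective _ (formMap_bijective hb hc)).surjective f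
      rw [LinearMap.comp_apply, LinearEquiv.coe_coe, LinearEquiv.symm_apply_apply]
      exact norm_toHDot_le hb hc u)

theorem formEmbedding_formMap {b c : ℝ} (hb : 0 < b) (hc : 0 < c) (u : H1) :
    formEmbedding hb hc (formMap b c u) = toHDot u :=
  congrArg toHDot ((LinearEquiv.ofBijective _ (formMap_bijective hb hc)).symm_apply_apply u)

end HamiltonianKrein

end

theorem mainTheorem8 (b c : ℝ) (hb : 0 < b) (hc : 0 < c) (V : ℝ → ℝ)
    (hV : MeasureTheory.Integrable V) :
    IsSelfAdjoint (HamiltonianKrein.opL b c V hV) ∧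
      ∀ E : HamiltonianKrein.ProjectionMeasure HamiltonianKrein.HDot,
        E.IsSpectralMeasureOf (HamiltonianKrein.opL b c V hV) →
          FiniteDimensional ℂ (LinearMap.range (E.proj (Set.Iic 0)).toLinearMap) ∧
            (Module.finrank ℂ (LinearMap.range (E.proj (Set.Iic 0)).toLinearMap) : ℝ) ≤
              1 / (2 * b * c) * ∫ y, |HamiltonianKrein.negPart V y| := by
  -- Surjectivity lets quantifiers over `L²` be read as quantifiers over `H¹`, which matches the
  -- abstract description of the graph with `opGraph`.
  have hsurj := (HamiltonianKrein.formMap_bijective hb hc).2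
  refine HamiltonianKrein.isSelfAdjoint_and_finrank_le
    (HamiltonianKrein.continuous_evalKernel hb hc)
    (HamiltonianKrein.norm_sq_evalKernel hb hc) hV
    (J := HamiltonianKrein.formEmbedding hb hc) ?_ fun p ↦ ?_
  · intro f g hfg
    obtain ⟨u, rfl⟩ := hsurj f
    obtain ⟨v, rfl⟩ := hsurj g
    rw [HamiltonianKrein.formEmbedding_formMap, HamiltonianKrein.formEmbedding_formMap] at hfg
    rw [HamiltonianKrein.toHDot_injective hfg]
  · rw [HamiltonianKrein.graph_opL, hsurj.exists]
    simp only [hsurj.forall, HamiltonianKrein.formEmbedding_formMap,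
      ← HamiltonianKrein.tForm_eq hb hc]
    rfl
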